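/- Let $(A,G)$ be a C*-dynamical system with $G$ discrete, i.e. $A$ is a (not necessarily unital) C*-algebra and $\alpha$ is a homomorphism from the group $G$ into the group of $*$-automorphisms of $A$. Ideals of C*-algebras are closed and two-sided. Let $A\rtimes_r G$ be the reduced crossed product, which contains $A$ canonically, and let $E\colon A\rtimes_r G\to A$ be the canonical conditional expectation, i.e. the continuous extension of $\sum_{t} a_tu_t\mapsto a_e$. Then the following are equivalent. (i) $A$ separates the ideals in $A\rtimes_r G$: the map $J\mapsto J\cap A$ from the ideals of $A\rtimes_r G$ to the $G$-invariant ideals of $A$ is injective. (ii) The action is exact, and for every positive $x\in A\rtimes_r G$ the element $E(x)$ belongs to the smallest ideal of $A\rtimes_r G$ containing $x$. (iii) The action is exact and has the residual intersection property. Here the action is called exact if for every $G$-invariant ideal $I$ of $A$ the sequence $$0\to I\rtimes_r G\to A\rtimes_r G\to (A/I)\rtimes_r G\to 0,$$ whose maps are induced by the inclusion $I\to A$ and the quotient map $A\to A/I$, is exact. An action of $G$ on a C*-algebra $B$ has the intersection property if every non-zero ideal of $B\rtimes_r G$ has non-zero intersection with $B$; the action on $A$ has the residual intersection property if for every $G$-invariant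 ideal $I$ of $A$ the induced action of $G$ on $A/I$ has the intersection property. -/

import Mathlib

namespace CStarDynamics

universe u v

noncomputable section

section Algebraic

variable {A : Type u} [NonUnitalCStarAlgebra A] {G : Type v} [Group G]

/-- The space `C_c(G, A)` of finitely supported functions from the discrete group `G` to `A`,
written in the literature as finite sums `∑ a_t u_t`.  The action `α` is part of the type because
product and involution depend on it. -/
def Cc (_α : G →* (A ≃⋆ₐ[ℂ] A)) : Type max u v := G →₀ A

namespace Cc

variable (α : G →* (A ≃⋆ₐ[ℂ] A))

instance : AddCommGroup (Cc α) := inferInstanceAs (AddCommGroup (G →₀ A))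

instance : Module ℂ (Cc α) := inferInstanceAs (Module ℂ (G →₀ A))

instance : FunLike (Cc α) G A := inferInstanceAs (FunLike (G →₀ A) G A)

/-- The element `a u_t` of `C_c(G, A)`. -/
def single (t : G) (a : A) : Cc α := Finsupp.single t a

/-- Twisted convolution: the bilinear product with `(a u_s) (b u_t) = a α_s(b) u_{st}`. -/
instance : Mul (Cc α) where
  mul f g := Finsupp.sum f fun s a => Finsupp.sum g fun t b => single α (s * t) (a * α s b)

/-- The conjugate linear involution with `(a u_s)^* = α_{s⁻¹}(a^*) u_{s⁻¹}`. -/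
instance : Star (Cc α) where
  star f := Finsupp.sum f fun s a => single α s⁻¹ (α s⁻¹ (star a))

variable {α}

theorem ext' {f g : Cc α} (h : ∀ t, f t = g t) : f = g := Finsupp.ext h

theorem add_apply (f g : Cc α) (t : G) : (f + g) t = f t + g t := rfl

theorem smul_apply (c : ℂ) (f : Cc α) (t : G) : (c • f) t = c • f t := rfl

theorem zero_apply (t : G) : (0 : Cc α) t = 0 := rfl

theorem single_self (t : G) (a : A) : single α t a t = a := Finsupp.single_eq_same

theorem single_ne {s t : G} (h : s ≠ t) (a : A) : single α s a t = 0 :=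
  Finsupp.single_eq_of_ne h.symm

theorem single_add (t : G) (a b : A) : single α t (a + b) = single α t a + single α t b :=
  Finsupp.single_add t a b

theorem single_zero (t : G) : single α t (0 : A) = 0 := Finsupp.single_zero t

theorem single_smul (c : ℂ) (t : G) (a : A) : single α t (c • a) = c • single α t a :=
  (Finsupp.smul_single c t a).symm

theorem ind {p : Cc α → Prop} (f : Cc α) (h0 : p 0) (ha : ∀ f g, p f → p g → p (f + g))
    (hs : ∀ t a, p (single α t a)) : p f :=
  Finsupp.induction_linear f h0 ha hs

theorem alpha_mul (s t : G) (a : A) : α (s * t) a = α s (α t a) := by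
  rw [map_mul]; rfl

theorem alpha_one (a : A) : α 1 a = a := by
  rw [map_one]; rfl

theorem alpha_inv (s : G) (a : A) : α s⁻¹ (α s a) = a := by
  rw [← alpha_mul, inv_mul_cancel, alpha_one]

theorem alpha_inv' (s : G) (a : A) : α s (α s⁻¹ a) = a := by
  rw [← alpha_mul, mul_inv_cancel, alpha_one]

protected theorem mul_def (f g : Cc α) :
    f * g = Finsupp.sum f fun s a => Finsupp.sum g fun t b => single α (s * t) (a * α s b) := rfl

protected theorem star_def (f : Cc α) :
    star f = Finsupp.sum f fun s a => single α s⁻¹ (α s⁻¹ (star a)) := rfl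

protected theorem add_mul' (f g h : Cc α) : (f + g) * h = f * h + g * h := by
  simp only [Cc.mul_def]
  refine Finsupp.sum_add_index' (fun s => ?_) (fun s a b => ?_)
  · simp only [MulZeroClass.zero_mul, single_zero]
    exact Finset.sum_const_zero
  · simp only [_root_.add_mul, single_add]
    exact Finsupp.sum_add

protected theorem mul_add' (f g h : Cc α) : f * (g + h) = f * g + f * h := by
  simp only [Cc.mul_def]
  refine Eq.trans ?_ Finsupp.sum_add
  refine Finsupp.sum_congr fun s _ => ?_
  refine Finsupp.sum_add_index' (fun t => ?_) (fun t a b => ?_)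
  · simp [single_zero]
  · simp only [map_add, _root_.mul_add, single_add]

theorem single_mul_single (s t : G) (a b : A) :
    single α s a * single α t b = single α (s * t) (a * α s b) := by
  rw [Cc.mul_def]
  refine (Finsupp.sum_single_index ?_).trans (Finsupp.sum_single_index ?_)
  · simp only [MulZeroClass.zero_mul, single_zero]
    exact Finset.sum_const_zero
  · simp [single_zero]

protected theorem zero_mul' (f : Cc α) : 0 * f = 0 := Finsupp.sum_zero_index

protected theorem mul_zero' (f : Cc α) : f * 0 = 0 := by
  have := Cc.mul_add' f 0 0
  simpa using this

protected theorem star_add' (f g : Cc α) : star (f + g) = star f + star g := by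
  simp only [Cc.star_def]
  refine Finsupp.sum_add_index' (fun s => ?_) (fun s a b => ?_)
  · simp [single_zero]
  · simp only [star_add, map_add, single_add]

theorem star_single (s : G) (a : A) : star (single α s a) = single α s⁻¹ (α s⁻¹ (star a)) := by
  rw [Cc.star_def]
  exact Finsupp.sum_single_index (by simp [single_zero])

protected theorem star_zero' : star (0 : Cc α) = 0 := Finsupp.sum_zero_index

instance : NonUnitalRing (Cc α) where
  left_distrib := Cc.mul_add'
  right_distrib := Cc.add_mul'
  zero_mul := Cc.zero_mul'
  mul_zero := Cc.mul_zero'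
  mul_assoc f g h := by
    induction f using Cc.ind with
    | h0 => simp only [Cc.zero_mul']
    | ha f g hf hg => simp only [Cc.add_mul', hf, hg]
    | hs r a =>
      induction g using Cc.ind with
      | h0 => simp only [Cc.zero_mul', Cc.mul_zero']
      | ha f g hf hg => simp only [Cc.add_mul', Cc.mul_add', hf, hg]
      | hs s b =>
        induction h using Cc.ind with
        | h0 => simp only [Cc.mul_zero']
        | ha f g hf hg => simp only [Cc.mul_add', hf, hg]
        | hs t c => simp only [single_mul_single, mul_assoc, alpha_mul, map_mul (α r)]

instance : StarRing (Cc α) where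
  star_involutive f := by
    induction f using Cc.ind with
    | h0 => simp only [Cc.star_zero']
    | ha f g hf hg => simp only [Cc.star_add', hf, hg]
    | hs r a => simp only [star_single, ← map_star, star_star, inv_inv, alpha_inv']
  star_add := Cc.star_add'
  star_mul f g := by
    induction f using Cc.ind with
    | h0 => simp only [zero_mul, mul_zero, Cc.star_zero']
    | ha f g hf hg => simp only [add_mul, mul_add, Cc.star_add', hf, hg]
    | hs r a =>
      induction g using Cc.ind with
      | h0 => simp only [zero_mul, mul_zero, Cc.star_zero']
      | ha f g hf hg => simp only [add_mul, mul_add, Cc.star_add', hf, hg]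
      | hs s b =>
        simp only [single_mul_single, star_single, star_mul, mul_inv_rev, alpha_mul,
          ← map_star, map_mul (α _), alpha_inv]

instance : IsScalarTower ℂ (Cc α) (Cc α) where
  smul_assoc c f g := by
    simp only [smul_eq_mul]
    induction f using Cc.ind with
    | h0 => simp only [smul_zero, zero_mul]
    | ha f g hf hg => simp only [smul_add, add_mul, hf, hg]
    | hs r a =>
      induction g using Cc.ind with
      | h0 => simp only [smul_zero, mul_zero]
      | ha f g hf hg => simp only [smul_add, mul_add, hf, hg]
      | hs s b => simp only [← single_smul, single_mul_single, smul_mul_assoc]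

instance : SMulCommClass ℂ (Cc α) (Cc α) where
  smul_comm c f g := by
    simp only [smul_eq_mul]
    induction f using Cc.ind with
    | h0 => simp only [smul_zero, zero_mul]
    | ha f g hf hg => simp only [smul_add, add_mul, hf, hg]
    | hs r a =>
      induction g using Cc.ind with
      | h0 => simp only [smul_zero, mul_zero]
      | ha f g hf hg => simp only [smul_add, mul_add, hf, hg]
      | hs s b => simp only [← single_smul, single_mul_single, map_smul, mul_smul_comm]

instance : StarModule ℂ (Cc α) where
  star_smul c f := by
    induction f using Cc.ind with
    | h0 => simp only [smul_zero, star_zero]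
    | ha f g hf hg => simp only [smul_add, star_add, hf, hg]
    | hs r a => simp only [← single_smul, star_single, star_smul, map_smul]

/-- The `A`-valued inner product `⟪ξ, η⟫ = E(ξ^* η) = ∑ α_{t⁻¹}(ξ(t)^* η(t))` on `C_c(G, A)`.
The bijection `ξ ↦ ξ'`, `ξ'(t) = α_{t⁻¹}(ξ(t))`, carries it to the usual inner product
`∑ ξ'(t)^* η'(t)` of the Hilbert module `ℓ²(G, A)`, and carries left multiplication by `a u_s`
to the usual regular representation, `ξ' ↦ (t ↦ α_{t⁻¹}(a) ξ'(s⁻¹ t))`. -/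
def ip (ξ η : Cc α) : A := Finsupp.sum ξ fun t a => α t⁻¹ (star a * η t)

theorem ip_eq (ξ η : Cc α) : ip ξ η = (star ξ * η) 1 := by
  induction ξ using Cc.ind with
  | h0 => simp only [star_zero, zero_mul]; exact Finsupp.sum_zero_index
  | ha f g hf hg =>
    rw [star_add, add_mul, add_apply, ← hf, ← hg]
    exact Finsupp.sum_add_index' (fun s => by simp) (fun s a b => by simp [add_mul])
  | hs s a =>
    refine (Finsupp.sum_single_index (by simp)).trans ?_
    induction η using Cc.ind with
    | h0 => simp [zero_apply]
    | ha f g hf hg => simp only [mul_add, add_apply, map_add, hf, hg]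
    | hs t b =>
      rw [star_single, single_mul_single]
      by_cases h : t = s
      · subst h
        simp [single_self]
      · rw [single_ne h, single_ne (by rwa [ne_eq, inv_mul_eq_one, eq_comm])]
        simp

end Cc

end Algebraic
section Norm

variable {A : Type u} [NonUnitalCStarAlgebra A] {G : Type v} [Group G]
variable {α : G →* (A ≃⋆ₐ[ℂ] A)}

attribute [local instance] CStarAlgebra.spectralOrder CStarAlgebra.spectralOrderedRing

namespace Cc

theorem star_apply_one (f : Cc α) : (star f) 1 = star (f 1) := by
  induction f using Cc.ind with
  | h0 => simp [zero_apply]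
  | ha f g hf hg => simp only [star_add, add_apply, hf, hg]
  | hs s a =>
    rw [star_single]
    by_cases h : s = 1
    · subst h; simp [single_self]
    · rw [single_ne h, single_ne (by simpa using h), star_zero]

theorem mul_single_one_apply (f : Cc α) (a : A) (t : G) :
    (f * single α 1 a) t = f t * α t a := by
  induction f using Cc.ind with
  | h0 => simp [zero_apply]
  | ha f g hf hg => simp only [add_mul, add_apply, hf, hg]
  | hs s b =>
    rw [single_mul_single, mul_one]
    by_cases h : s = t
    · subst h; simp [single_self]
    · rw [single_ne h, single_ne h, zero_mul]

theorem single_one_mul_apply (f : Cc α) (a : A) (t : G) :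
    (single α 1 a * f) t = a * f t := by
  induction f using Cc.ind with
  | h0 => simp [zero_apply]
  | ha f g hf hg => simp only [mul_add, add_apply, hf, hg]
  | hs s b =>
    rw [single_mul_single, one_mul, alpha_one]
    by_cases h : s = t
    · subst h; simp [single_self]
    · rw [single_ne h, single_ne h, mul_zero]

theorem ip_add_right (ξ η ζ : Cc α) : ip ξ (η + ζ) = ip ξ η + ip ξ ζ := by
  simp only [ip_eq, mul_add, add_apply]

theorem ip_smul_right (c : ℂ) (ξ η : Cc α) : ip ξ (c • η) = c • ip ξ η := by
  simp only [ip_eq, mul_smul_comm, smul_apply]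

theorem star_ip (ξ η : Cc α) : star (ip ξ η) = ip η ξ := by
  simp only [ip_eq, ← star_apply_one, star_mul, star_star]

theorem ip_add_left (ξ η ζ : Cc α) : ip (ξ + η) ζ = ip ξ ζ + ip η ζ := by
  simp only [ip_eq, star_add, add_mul, add_apply]

theorem ip_smul_left (c : ℂ) (ξ η : Cc α) : ip (c • ξ) η = star c • ip ξ η := by
  simp only [ip_eq, star_smul, smul_mul_assoc, smul_apply]

theorem ip_mul_left (f ξ η : Cc α) : ip (f * ξ) η = ip ξ (star f * η) := by
  simp only [ip_eq, star_mul, mul_assoc]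

theorem ip_right (ξ η : Cc α) (a : A) : ip ξ (η * single α 1 a) = ip ξ η * a := by
  simp only [ip_eq, ← mul_assoc, mul_single_one_apply, alpha_one]

theorem ip_left (ξ η : Cc α) (a : A) : ip (ξ * single α 1 a) η = star a * ip ξ η := by
  rw [← star_ip, ip_right, star_mul, star_ip]

theorem alpha_star_mul_nonneg (t : G) (a : A) : 0 ≤ α t (star a * a) := by
  rw [map_mul (α t), map_star]
  exact star_mul_self_nonneg _

theorem ip_self_nonneg (ξ : Cc α) : 0 ≤ ip ξ ξ :=
  Finset.sum_nonneg fun _ _ => alpha_star_mul_nonneg _ _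

theorem star_mul_le_ip (ξ : Cc α) (t : G) : α t⁻¹ (star (ξ t) * ξ t) ≤ ip ξ ξ := by
  by_cases h : t ∈ Finsupp.support ξ
  · exact Finset.single_le_sum (f := fun t => α t⁻¹ (star (ξ t) * ξ t))
      (fun _ _ => alpha_star_mul_nonneg _ _) h
  · have : ξ t = 0 := Finsupp.notMem_support_iff.1 h
    simpa [this] using ip_self_nonneg ξ

theorem ip_self_eq_zero {ξ : Cc α} (h : ip ξ ξ = 0) : ξ = 0 := by
  refine ext' fun t => ?_
  have h1 : α t⁻¹ (star (ξ t) * ξ t) = 0 :=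
    le_antisymm (h ▸ star_mul_le_ip ξ t) (alpha_star_mul_nonneg _ _)
  have h2 : star (ξ t) * ξ t = 0 := by
    have := congrArg (α t) h1
    rwa [alpha_inv', map_zero] at this
  exact CStarRing.star_mul_self_eq_zero_iff _ |>.1 h2

/-- The norm `‖ξ‖₂ = ‖⟪ξ, ξ⟫‖^{1/2}` of the pre-Hilbert `A`-module `C_c(G, A)`. -/
def l2norm (ξ : Cc α) : ℝ := √‖ip ξ ξ‖

theorem l2norm_nonneg (ξ : Cc α) : 0 ≤ l2norm ξ := Real.sqrt_nonneg _

theorem l2norm_sq (ξ : Cc α) : l2norm ξ ^ 2 = ‖ip ξ ξ‖ := Real.sq_sqrt (norm_nonneg _)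

theorem norm_ip_le (ξ η : Cc α) : ‖ip ξ η‖ ≤ l2norm ξ * l2norm η := by
  rcases eq_or_ne ξ 0 with rfl | hξ
  · have : ip (0 : Cc α) η = 0 := Finsupp.sum_zero_index
    rw [this, norm_zero]
    exact mul_nonneg (l2norm_nonneg _) (l2norm_nonneg _)
  have hpos : 0 < ‖ip ξ ξ‖ := norm_pos_iff.2 fun h => hξ (ip_self_eq_zero h)
  set t : ℝ := ‖ip ξ ξ‖ with ht
  set a : A := ip ξ η with ha
  have ha' : ip η ξ = star a := (star_ip ξ η).symm
  have key : star a * a ≤ t • ip η η := by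
    have h0 : 0 ≤ ip (ξ * single α 1 a + (-(t : ℂ)) • η) (ξ * single α 1 a + (-(t : ℂ)) • η) :=
      ip_self_nonneg _
    have h1 : ip (ξ * single α 1 a + (-(t : ℂ)) • η) (ξ * single α 1 a + (-(t : ℂ)) • η)
        = star a * ip ξ ξ * a - t • (star a * a) - t • (star a * a) + t • (t • ip η η) := by
      simp only [ip_add_left, ip_add_right, ip_smul_left, ip_smul_right, ip_left, ip_right]
      simp only [← ha, ha', star_neg, neg_smul, RCLike.star_def, Complex.conj_ofReal, Complex.coe_smul]
      simp only [add_mul, neg_mul, smul_mul_assoc, smul_add, smul_neg, mul_assoc]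
      abel
    have h2 : star a * ip ξ ξ * a ≤ t • (star a * a) :=
      CStarAlgebra.star_left_conjugate_le_norm_smul (ip_self_nonneg ξ).isSelfAdjoint
    have h3 : 0 ≤ t • (t • ip η η - star a * a) := by
      rw [smul_sub]
      calc (0 : A) ≤ _ := h0
        _ = _ := h1
        _ ≤ t • (star a * a) - t • (star a * a) - t • (star a * a) + t • (t • ip η η) := by
            gcongr
        _ = _ := by abel
    have h4 : (0 : A) ≤ t⁻¹ • (t • (t • ip η η - star a * a)) :=
      smul_nonneg (inv_nonneg.2 hpos.le) h3
    rw [smul_smul, inv_mul_cancel₀ hpos.ne', one_smul] at h4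
    exact sub_nonneg.1 h4
  have h5 : ‖star a * a‖ ≤ ‖t • ip η η‖ :=
    CStarAlgebra.norm_le_norm_of_nonneg_of_le (star_mul_self_nonneg _) key
  rw [CStarRing.norm_star_mul_self, norm_smul, Real.norm_of_nonneg hpos.le, ht, ← l2norm_sq,
    ← l2norm_sq] at h5
  exact abs_le_of_sq_le_sq' (by nlinarith) (mul_nonneg (l2norm_nonneg _) (l2norm_nonneg _)) |>.2

theorem l2norm_add_le (ξ η : Cc α) : l2norm (ξ + η) ≤ l2norm ξ + l2norm η := by
  have h0 := l2norm_nonneg ξ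
  have h1 := l2norm_nonneg η
  refine abs_le_of_sq_le_sq' ?_ (add_nonneg h0 h1) |>.2
  have h : ip (ξ + η) (ξ + η) = ip ξ ξ + ip ξ η + ip η ξ + ip η η := by
    simp only [ip_add_left, ip_add_right]; abel
  rw [l2norm_sq, h]
  have := norm_add_le (ip ξ ξ + ip ξ η + ip η ξ) (ip η η)
  have := norm_add₃_le (a := ip ξ ξ) (b := ip ξ η) (c := ip η ξ)
  have := norm_ip_le ξ η
  have := norm_ip_le η ξ
  have := l2norm_sq ξ
  have := l2norm_sq η
  nlinarith

theorem l2norm_smul (c : ℂ) (ξ : Cc α) : l2norm (c • ξ) = ‖c‖ * l2norm ξ := by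
  rw [l2norm, ip_smul_left, ip_smul_right, smul_smul, norm_smul, norm_mul, norm_star,
    Real.sqrt_mul (mul_self_nonneg _), Real.sqrt_mul_self (norm_nonneg _), l2norm]

theorem l2norm_single_mul_le (t : G) (a : A) (ξ : Cc α) :
    l2norm (single α t a * ξ) ≤ √‖α t⁻¹ (star a * a)‖ * l2norm ξ := by
  rw [l2norm, l2norm, ← Real.sqrt_mul (norm_nonneg _)]
  refine Real.sqrt_le_sqrt ?_
  have h1 : star (single α t a) * single α t a = single α 1 (α t⁻¹ (star a * a)) := by
    rw [star_single, single_mul_single, inv_mul_cancel, map_mul (α _)]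
  set b := α t⁻¹ (star a * a) with hb
  rw [ip_mul_left, ← mul_assoc, h1]
  have hb0 : 0 ≤ b := alpha_star_mul_nonneg _ _
  have h2 : ip ξ (single α 1 b * ξ) ≤ ‖b‖ • ip ξ ξ := by
    unfold ip Finsupp.sum
    rw [Finset.smul_sum]
    refine Finset.sum_le_sum fun s _ => ?_
    change α s⁻¹ (star (ξ s) * (single α 1 b * ξ) s) ≤ ‖b‖ • α s⁻¹ (star (ξ s) * ξ s)
    rw [single_one_mul_apply, map_mul, map_mul, map_mul, map_star, ← mul_assoc]
    have h3 : IsSelfAdjoint (α s⁻¹ b) := hb0.isSelfAdjoint.map (α s⁻¹)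
    have h4 : ‖α s⁻¹ b‖ ≤ ‖b‖ := NonUnitalStarAlgHom.norm_apply_le (α s⁻¹) b
    refine (CStarAlgebra.star_left_conjugate_le_norm_smul h3).trans ?_
    exact smul_le_smul_of_nonneg_right h4 (star_mul_self_nonneg _)
  have h5 : 0 ≤ ip ξ (single α 1 b * ξ) := by
    rw [← h1, mul_assoc, ← ip_mul_left]; exact ip_self_nonneg _
  refine (CStarAlgebra.norm_le_norm_of_nonneg_of_le h5 h2).trans ?_
  rw [norm_smul, norm_norm]

theorem l2norm_mul_bound (f : Cc α) : ∃ C, ∀ ξ, l2norm (f * ξ) ≤ C * l2norm ξ := by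
  induction f using Cc.ind with
  | h0 => exact ⟨0, fun ξ => by simp [l2norm, ip_eq, zero_apply]⟩
  | ha f g hf hg =>
    obtain ⟨C, hC⟩ := hf
    obtain ⟨D, hD⟩ := hg
    refine ⟨C + D, fun ξ => ?_⟩
    rw [add_mul, add_mul]
    exact (l2norm_add_le _ _).trans (add_le_add (hC ξ) (hD ξ))
  | hs t a => exact ⟨_, l2norm_single_mul_le t a⟩

end Cc

/-- The space `C_c(G, A)` regarded as a pre-Hilbert `A`-module, with norm `‖⟪ξ, ξ⟫‖^{1/2}`.
Its completion is the Hilbert module `ℓ²(G, A)`. -/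
def L2 (α : G →* (A ≃⋆ₐ[ℂ] A)) : Type max u v := Cc α

namespace L2

instance : AddCommGroup (L2 α) := inferInstanceAs (AddCommGroup (Cc α))

instance : Module ℂ (L2 α) := inferInstanceAs (Module ℂ (Cc α))

instance : Norm (L2 α) := ⟨fun ξ => Cc.l2norm (α := α) ξ⟩

theorem core : NormedSpace.Core ℂ (L2 α) where
  norm_nonneg ξ := Cc.l2norm_nonneg (α := α) ξ
  norm_smul c ξ := Cc.l2norm_smul (α := α) c ξ
  norm_triangle ξ η := Cc.l2norm_add_le (α := α) ξ η
  norm_eq_zero_iff ξ := by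
    constructor
    · intro h
      have h1 : √‖Cc.ip (α := α) ξ ξ‖ = 0 := h
      rw [Real.sqrt_eq_zero (norm_nonneg _), norm_eq_zero] at h1
      exact Cc.ip_self_eq_zero (α := α) h1
    · rintro rfl
      change √‖Cc.ip (α := α) 0 0‖ = 0
      rw [Cc.ip_eq]
      simp [Cc.zero_apply]

instance : NormedAddCommGroup (L2 α) := NormedAddCommGroup.ofCore core

instance : NormedSpace ℂ (L2 α) := NormedSpace.ofCore core

end L2

namespace Cc

/-- The left regular representation of `C_c(G, A)` on (the dense subspace `C_c(G, A)` of)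
`ℓ²(G, A)`. -/
def regRep (α : G →* (A ≃⋆ₐ[ℂ] A)) : Cc α →ₗ[ℂ] (L2 α →L[ℂ] L2 α) where
  toFun f := LinearMap.mkContinuousOfExistsBound
    (show L2 α →ₗ[ℂ] L2 α from LinearMap.mulLeft ℂ f) (l2norm_mul_bound f)
  map_add' f g := by ext ξ; exact add_mul (R := Cc α) f g ξ
  map_smul' c f := by ext ξ; exact smul_mul_assoc (α := ℂ) (β := Cc α) c f ξ

theorem regRep_apply (f ξ : Cc α) : regRep α f (show L2 α from ξ) = f * ξ := rfl

theorem regRep_injective : Function.Injective (regRep α) := by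
  refine (injective_iff_map_eq_zero _).2 fun f hf => ext' fun t => ?_
  have h : f * single α 1 (α t⁻¹ (star (f t))) = 0 :=
    DFunLike.congr_fun hf (single α 1 (α t⁻¹ (star (f t))) : L2 α)
  have h1 := mul_single_one_apply f (α t⁻¹ (star (f t))) t
  rw [h, alpha_inv', zero_apply] at h1
  exact (CStarRing.mul_star_self_eq_zero_iff _).1 h1.symm

/-- The reduced norm `‖f‖_λ`: the operator norm of `f` in the left regular representation. -/
instance : NormedAddCommGroup (Cc α) :=
  NormedAddCommGroup.induced (Cc α) (L2 α →L[ℂ] L2 α) (regRep α) regRep_injective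

theorem norm_def (f : Cc α) : ‖f‖ = ‖regRep α f‖ := rfl

theorem l2norm_mul_le (f ξ : Cc α) : l2norm (f * ξ) ≤ ‖f‖ * l2norm ξ :=
  (regRep α f).le_opNorm (ξ : L2 α)

theorem norm_le_of {f : Cc α} {C : ℝ} (hC : 0 ≤ C) (h : ∀ ξ, l2norm (f * ξ) ≤ C * l2norm ξ) :
    ‖f‖ ≤ C :=
  (regRep α f).opNorm_le_bound hC h

instance : NonUnitalNormedRing (Cc α) where
  dist_eq _ _ := dist_eq_norm_neg_add _ _
  norm_mul_le f g := by
    refine norm_le_of (mul_nonneg (norm_nonneg _) (norm_nonneg _)) fun ξ => ?_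
    rw [mul_assoc, mul_assoc]
    exact (l2norm_mul_le _ _).trans
      (mul_le_mul_of_nonneg_left (l2norm_mul_le _ _) (norm_nonneg _))

instance : NormedSpace ℂ (Cc α) where
  norm_smul_le c f := by
    rw [norm_def, norm_def, map_smul]
    exact (norm_smul c (regRep α f)).le

instance : CStarRing (Cc α) where
  norm_mul_self_le f := by
    rw [← sq]
    have h : ‖f‖ ≤ √‖star f * f‖ := by
      refine norm_le_of (Real.sqrt_nonneg _) fun ξ => ?_
      refine abs_le_of_sq_le_sq' ?_ (mul_nonneg (Real.sqrt_nonneg _) (l2norm_nonneg _)) |>.2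
      rw [mul_pow, Real.sq_sqrt (norm_nonneg _), l2norm_sq, ip_mul_left, ← mul_assoc]
      refine (norm_ip_le _ _).trans ?_
      have := mul_le_mul_of_nonneg_left (l2norm_mul_le (star f * f) ξ) (l2norm_nonneg ξ)
      nlinarith
    calc ‖f‖ ^ 2 ≤ √‖star f * f‖ ^ 2 := by gcongr
      _ = _ := Real.sq_sqrt (norm_nonneg _)

theorem l2norm_single_one (a : A) : l2norm (single α 1 a) = ‖a‖ := by
  rw [l2norm, ip_eq, star_single, single_mul_single, inv_one, mul_one, single_self, alpha_one,
    alpha_one, CStarRing.norm_star_mul_self, Real.sqrt_mul_self (norm_nonneg _)]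

theorem norm_apply_one_le_l2norm (ξ : Cc α) : ‖ξ 1‖ ≤ l2norm ξ := by
  have h := CStarAlgebra.norm_le_norm_of_nonneg_of_le (alpha_star_mul_nonneg _ _)
    (star_mul_le_ip ξ 1)
  rw [inv_one, alpha_one, CStarRing.norm_star_mul_self] at h
  rw [l2norm]
  exact Real.le_sqrt_of_sq_le (by rwa [sq])

theorem norm_apply_one_le (f : Cc α) : ‖f 1‖ ≤ ‖f‖ := by
  have h := (norm_apply_one_le_l2norm _).trans (l2norm_mul_le f (single α 1 (star (f 1))))
  rw [l2norm_single_one, mul_single_one_apply, alpha_one, CStarRing.norm_self_mul_star,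
    norm_star] at h
  by_contra! hc
  have : 0 < ‖f 1‖ := (norm_nonneg f).trans_lt hc
  nlinarith

theorem norm_single_one (a : A) : ‖single α 1 a‖ = ‖a‖ := by
  refine le_antisymm (norm_le_of (norm_nonneg _) fun ξ => ?_) ?_
  · have := l2norm_single_mul_le 1 a ξ
    rwa [inv_one, alpha_one, CStarRing.norm_star_mul_self,
      Real.sqrt_mul_self (norm_nonneg _)] at this
  · have := norm_apply_one_le (single α 1 a)
    rwa [single_self] at this

end Cc

end Norm
section Completion

open UniformSpace

set_option linter.unusedSectionVars false

/-! The completion of a complex normed `*`-algebra with the C*-identity is a C*-algebra. -/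

variable (E : Type u) [NonUnitalNormedRing E] [StarRing E] [CStarRing E] [NormedSpace ℂ E]
  [IsScalarTower ℂ E E] [SMulCommClass ℂ E E] [StarModule ℂ E]

namespace CompletionAux

abbrev mulC : Mul (Completion E) :=
  ⟨Function.curry <| (Completion.isDenseInducing_coe.prodMap
    Completion.isDenseInducing_coe).extend
      ((↑) ∘ Function.uncurry (fun x y : E => x * y))⟩

abbrev starC : Star (Completion E) := ⟨Completion.map (star : E → E)⟩

attribute [local instance] mulC starC

variable {E}

theorem coe_mul (a b : E) : ((a * b : E) : Completion E) = a * b :=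
  ((Completion.isDenseInducing_coe.prodMap Completion.isDenseInducing_coe).extend_eq
      ((Completion.continuous_coe E).comp (@continuous_mul E _ _ _)) (a, b)).symm

theorem coe_star (a : E) : ((star a : E) : Completion E) = star (a : Completion E) :=
  (Completion.map_coe (starNormedAddGroupHom (E := E)).uniformContinuous a).symm

theorem continuous_star' : Continuous fun x : Completion E => star x :=
  Completion.continuous_map

theorem continuousMul : ContinuousMul (Completion E) := by
  constructor
  let m := (AddMonoidHom.mul : E →+ E →+ E).compr₂ Completion.toCompl
  have : Continuous fun p : E × E => m p.1 p.2 :=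
    (Completion.continuous_coe E).comp continuous_mul
  have di : IsDenseInducing (Completion.toCompl : E → Completion E) :=
    Completion.isDenseInducing_coe
  exact (di.extend_Z_bilin di this :)

end CompletionAux

open CompletionAux in
attribute [local instance] mulC starC continuousMul in
/-- The completion of a complex normed `*`-algebra with the C*-identity, as a C*-algebra. -/
abbrev completionCStarAlgebra : NonUnitalCStarAlgebra (Completion E) where
  __ : NormedAddCommGroup (Completion E) := inferInstance
  __ : NormedSpace ℂ (Completion E) := inferInstance
  __ : CompleteSpace (Completion E) := inferInstance
  dist_eq _ _ := dist_eq_norm_neg_add _ _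
  mul := (mulC E).mul
  star := (starC E).star
  zero_mul a :=
    Completion.induction_on a (isClosed_eq (by fun_prop) continuous_const)
      fun a => by rw [← Completion.coe_zero, ← coe_mul, zero_mul]
  mul_zero a :=
    Completion.induction_on a (isClosed_eq (by fun_prop) continuous_const)
      fun a => by rw [← Completion.coe_zero, ← coe_mul, mul_zero]
  mul_assoc a b c :=
    Completion.induction_on₃ a b c (isClosed_eq (by fun_prop) (by fun_prop))
      fun a b c => by simp only [← coe_mul, mul_assoc]
  left_distrib a b c :=
    Completion.induction_on₃ a b c (isClosed_eq (by fun_prop) (by fun_prop))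
      fun a b c => by simp only [← coe_mul, ← Completion.coe_add, mul_add]
  right_distrib a b c :=
    Completion.induction_on₃ a b c (isClosed_eq (by fun_prop) (by fun_prop))
      fun a b c => by simp only [← coe_mul, ← Completion.coe_add, add_mul]
  norm_mul_le a b :=
    Completion.induction_on₂ a b (isClosed_le (by fun_prop) (by fun_prop))
      fun a b => by simpa only [← coe_mul, Completion.norm_coe] using norm_mul_le a b
  star_involutive a :=
    Completion.induction_on a
      (isClosed_eq (continuous_star'.comp continuous_star') continuous_id)
      fun a => by simp only [← coe_star, star_star]
  star_mul a b :=
    Completion.induction_on₂ a b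
      (isClosed_eq (continuous_star'.comp continuous_mul)
        ((continuous_star'.comp continuous_snd).mul (continuous_star'.comp continuous_fst)))
      fun a b => by simp only [← coe_star, ← coe_mul, star_mul]
  star_add a b :=
    Completion.induction_on₂ a b
      (isClosed_eq (continuous_star'.comp continuous_add)
        ((continuous_star'.comp continuous_fst).add (continuous_star'.comp continuous_snd)))
      fun a b => by simp only [← coe_star, ← Completion.coe_add, star_add]
  norm_mul_self_le a :=
    Completion.induction_on a
      (isClosed_le (by fun_prop) ((continuous_star'.mul continuous_id).norm))
      fun a => by
        simpa only [← coe_star, ← coe_mul, Completion.norm_coe] using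
          CStarRing.norm_mul_self_le a
  smul_assoc c a b :=
    Completion.induction_on₂ a b
      (isClosed_eq ((continuous_fst.const_smul c).mul continuous_snd)
        (continuous_mul.const_smul c))
      fun a b => by simp only [smul_eq_mul, ← coe_mul, ← Completion.coe_smul, smul_mul_assoc]
  smul_comm c a b :=
    Completion.induction_on₂ a b
      (isClosed_eq (continuous_mul.const_smul c)
        (continuous_fst.mul (continuous_snd.const_smul c)))
      fun a b => by simp only [smul_eq_mul, ← coe_mul, ← Completion.coe_smul, mul_smul_comm]
  star_smul c a :=
    Completion.induction_on a
      (isClosed_eq (continuous_star'.comp (continuous_const_smul c))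
        ((continuous_const_smul (star c)).comp continuous_star'))
      fun a => by simp only [← coe_star, ← Completion.coe_smul, star_smul]

end Completion
section Functoriality

variable {A B : Type*} [NonUnitalCStarAlgebra A] [NonUnitalCStarAlgebra B]
  {G : Type v} [Group G]
variable {α : G →* (A ≃⋆ₐ[ℂ] A)} {β : G →* (B ≃⋆ₐ[ℂ] B)}

namespace Cc

/-- Auxiliary additive map underlying `Cc.map`. -/
def mapAdd (α : G →* (A ≃⋆ₐ[ℂ] A)) (β : G →* (B ≃⋆ₐ[ℂ] B)) (φ : A →⋆ₙₐ[ℂ] B) :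
    Cc α →+ Cc β :=
  (Finsupp.mapRange.addMonoidHom (φ : A →+ B) : (G →₀ A) →+ (G →₀ B))

theorem mapAdd_single (φ : A →⋆ₙₐ[ℂ] B) (t : G) (a : A) :
    mapAdd α β φ (single α t a) = single β t (φ a) :=
  Finsupp.mapRange_single (f := φ) (hf := map_zero φ)

/-- The `*`-homomorphism `∑ a_t u_t ↦ ∑ φ(a_t) u_t` induced by an equivariant
`*`-homomorphism `φ`. -/
def map (φ : A →⋆ₙₐ[ℂ] B) (hφ : ∀ t a, φ (α t a) = β t (φ a)) : Cc α →⋆ₙₐ[ℂ] Cc β where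
  toFun := mapAdd α β φ
  map_smul' c f := ext' fun t => map_smul φ c (f t)
  map_zero' := map_zero _
  map_add' := map_add _
  map_mul' f g := by
    induction f using Cc.ind with
    | h0 => simp only [zero_mul, map_zero]
    | ha f₁ f₂ h₁ h₂ => simp only [add_mul, map_add, h₁, h₂]
    | hs s a =>
      induction g using Cc.ind with
      | h0 => simp only [mul_zero, map_zero]
      | ha f₁ f₂ h₁ h₂ => simp only [mul_add, map_add, h₁, h₂]
      | hs t b => simp only [single_mul_single, mapAdd_single, map_mul φ, hφ]
  map_star' f := by
    induction f using Cc.ind with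
    | h0 => simp only [star_zero, map_zero]
    | ha f₁ f₂ h₁ h₂ => simp only [star_add, map_add, h₁, h₂]
    | hs s a => simp only [star_single, mapAdd_single, hφ, map_star φ]

variable {φ : A →⋆ₙₐ[ℂ] B} {hφ : ∀ t a, φ (α t a) = β t (φ a)}

theorem map_apply (f : Cc α) (t : G) : map φ hφ f t = φ (f t) := rfl

theorem star_single_mul_mul_single (s : G) (b : B) (h : Cc β) :
    (star (single β s b) * (h * single β s b)) 1 = β s⁻¹ (star b * h 1 * b) := by
  induction h using Cc.ind with
  | h0 => simp [zero_apply]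
  | ha f g hf hg => simp only [add_mul, mul_add, add_apply, hf, hg, map_add]
  | hs t a =>
    rw [star_single, single_mul_single, single_mul_single]
    by_cases h : t = 1
    · subst h
      rw [one_mul, inv_mul_cancel, single_self, single_self, alpha_one, map_mul (β _),
        map_mul (β _), map_mul (β _), mul_assoc]
    · rw [single_ne h, single_ne (by simpa [inv_mul_eq_one, eq_comm] using h)]
      simp

theorem l2norm_map_mul_bound (ξ : Cc β) :
    ∃ D, ∀ g : Cc α, l2norm (map φ hφ g * ξ) ≤ D * ‖g‖ := by
  induction ξ using Cc.ind with
  | h0 => exact ⟨0, fun ξ => by simp [l2norm, ip_eq, zero_apply]⟩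
  | ha f g hf hg =>
    obtain ⟨C, hC⟩ := hf
    obtain ⟨D, hD⟩ := hg
    refine ⟨C + D, fun ξ => ?_⟩
    rw [mul_add, add_mul]
    exact (l2norm_add_le _ _).trans (add_le_add (hC ξ) (hD ξ))
  | hs s b =>
    refine ⟨‖b‖, fun g => ?_⟩
    refine abs_le_of_sq_le_sq' ?_ (mul_nonneg (norm_nonneg _) (norm_nonneg _)) |>.2
    rw [l2norm_sq, ip_mul_left, ip_eq, ← mul_assoc (star _) (map φ hφ g), ← map_star, ← map_mul,
      star_single_mul_mul_single, map_apply]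
    calc _ ≤ ‖star b * φ ((star g * g) 1) * b‖ := NonUnitalStarAlgHom.norm_apply_le (β s⁻¹) _
      _ ≤ ‖star b‖ * ‖φ ((star g * g) 1)‖ * ‖b‖ := norm_mul₃_le
      _ ≤ ‖b‖ * ‖star g * g‖ * ‖b‖ := by
        rw [norm_star]
        gcongr
        exact (NonUnitalStarAlgHom.norm_apply_le φ _).trans (norm_apply_one_le _)
      _ = _ := by rw [CStarRing.norm_star_mul_self]; ring

theorem growth {a : ℕ → ℝ} {c M D : ℝ} (hc : 0 ≤ c) (hM : 0 ≤ M) (h0 : ∀ n, 0 ≤ a n)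
    (h1 : ∀ n, a n ^ 2 ≤ c * a (n + 1)) (h2 : ∀ n, a n ≤ D * M ^ 2 ^ n) : a 0 ≤ M * c := by
  by_contra! h
  rcases hc.eq_or_lt with rfl | hc
  · nlinarith [h1 0]
  rcases hM.eq_or_lt with rfl | hM
  · have := h2 0
    simp only [pow_zero, pow_one, mul_zero] at this
    linarith
  have h3 : ∀ n, (a 0 / c) ^ 2 ^ n ≤ a n / c := by
    intro n
    induction n with
    | zero => simp
    | succ n ih =>
      have hb : 0 ≤ (a 0 / c) ^ 2 ^ n := pow_nonneg (div_nonneg (h0 0) hc.le) _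
      calc (a 0 / c) ^ 2 ^ (n + 1) = ((a 0 / c) ^ 2 ^ n) ^ 2 := by rw [pow_succ, pow_mul]
        _ ≤ (a n / c) ^ 2 := by gcongr
        _ = a n ^ 2 / c / c := by rw [div_pow, sq c, div_div]
        _ ≤ c * a (n + 1) / c / c := by gcongr; exact h1 n
        _ = a (n + 1) / c := by rw [mul_div_cancel_left₀ _ hc.ne']
  set r := a 0 / c / M with hr
  have hr1 : 1 < r := by rw [hr, lt_div_iff₀ hM, one_mul, lt_div_iff₀ hc]; exact h
  have h4 : ∀ n, r ^ 2 ^ n ≤ D / c := by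
    intro n
    rw [hr, div_pow, div_le_iff₀ (by positivity)]
    refine (h3 n).trans ?_
    rw [div_mul_eq_mul_div]
    gcongr
    exact h2 n
  obtain ⟨n, hn⟩ := pow_unbounded_of_one_lt (D / c) hr1
  have h5 : r ^ n ≤ r ^ 2 ^ n := pow_le_pow_right₀ hr1.le n.lt_two_pow_self.le
  linarith [h4 n]

/-- The successive squares `f`, `f^* f`, `(f^* f)^* (f^* f)`, … -/
def sqs (f : Cc α) : ℕ → Cc α
  | 0 => f
  | n + 1 => star (sqs f n) * sqs f n

theorem norm_sqs (f : Cc α) (n : ℕ) : ‖sqs f n‖ = ‖f‖ ^ 2 ^ n := by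
  induction n with
  | zero => simp [sqs]
  | succ n ih => rw [sqs, CStarRing.norm_star_mul_self, ih, pow_succ, pow_mul, sq]

/-- The induced map is contractive for the reduced norms. -/
theorem norm_map_le (f : Cc α) : ‖map φ hφ f‖ ≤ ‖f‖ := by
  refine norm_le_of (norm_nonneg _) fun ξ => ?_
  obtain ⟨D, hD⟩ := l2norm_map_mul_bound (φ := φ) (hφ := hφ) ξ
  refine growth (a := fun n => l2norm (map φ hφ (sqs f n) * ξ)) (D := D) (l2norm_nonneg ξ)
    (norm_nonneg f) (fun n => l2norm_nonneg _) (fun n => ?_) (fun n => ?_)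
  · change l2norm _ ^ 2 ≤ l2norm ξ * l2norm (map φ hφ (star (sqs f n) * sqs f n) * ξ)
    rw [l2norm_sq, ip_mul_left, map_mul, map_star, mul_assoc]
    exact norm_ip_le _ _
  · rw [← norm_sqs]
    exact hD _

end Cc

end Functoriality

section Reduced

open UniformSpace

variable {A B : Type*} [NonUnitalCStarAlgebra A] [NonUnitalCStarAlgebra B]
  {G : Type v} [Group G]

/-- The reduced crossed product `A ⋊_r G`: the completion of `C_c(G, A)` in the reduced norm. -/
def Red (α : G →* (A ≃⋆ₐ[ℂ] A)) : Type _ := Completion (Cc α)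

namespace Red

instance (α : G →* (A ≃⋆ₐ[ℂ] A)) : NonUnitalCStarAlgebra (Red α) :=
  completionCStarAlgebra (Cc α)

/-- The canonical (isometric, dense) inclusion of `C_c(G, A)` in `A ⋊_r G`. -/
def ofCc (α : G →* (A ≃⋆ₐ[ℂ] A)) : Cc α →⋆ₙₐ[ℂ] Red α where
  toFun f := (f : Completion (Cc α))
  map_smul' c f := Completion.coe_smul c f
  map_zero' := Completion.coe_zero
  map_add' f g := Completion.coe_add f g
  map_mul' f g := CompletionAux.coe_mul f g
  map_star' f := CompletionAux.coe_star f

variable {α : G →* (A ≃⋆ₐ[ℂ] A)} {β : G →* (B ≃⋆ₐ[ℂ] B)}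

theorem norm_ofCc (f : Cc α) : ‖ofCc α f‖ = ‖f‖ := Completion.norm_coe f

theorem isometry_ofCc : Isometry (ofCc α) := Completion.coe_isometry

theorem denseRange_ofCc : DenseRange (ofCc α) := Completion.denseRange_coe

theorem ind {p : Red α → Prop} (x : Red α) (hp : IsClosed {x | p x}) (h : ∀ f, p (ofCc α f)) :
    p x :=
  Completion.induction_on (α := Cc α) x hp h

theorem ind₂ {p : Red α → Red α → Prop} (x y : Red α)
    (hp : IsClosed {z : Red α × Red α | p z.1 z.2}) (h : ∀ f g, p (ofCc α f) (ofCc α g)) :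
    p x y :=
  Completion.induction_on₂ (α := Cc α) (β := Cc α) x y hp h

variable (α) in
/-- The canonical inclusion `A ⊆ A ⋊_r G`, `a ↦ a u_e`. -/
def incl : A →⋆ₙₐ[ℂ] Red α where
  toFun a := ofCc α (Cc.single α 1 a)
  map_smul' c a := by rw [Cc.single_smul]; exact map_smul (ofCc α) _ _
  map_zero' := by rw [Cc.single_zero, map_zero]
  map_add' a b := by rw [Cc.single_add, map_add]
  map_mul' a b := by rw [← map_mul, Cc.single_mul_single, one_mul, Cc.alpha_one]
  map_star' a := by rw [← map_star, Cc.star_single, inv_one, Cc.alpha_one]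

theorem norm_incl (a : A) : ‖incl α a‖ = ‖a‖ := (norm_ofCc _).trans (Cc.norm_single_one a)

theorem isometry_incl : Isometry (incl α) := AddMonoidHomClass.isometry_of_norm _ norm_incl

variable (α) in
/-- The map `∑ a_t u_t ↦ a_e` on `C_c(G, A)`. -/
def evalOne : Cc α →L[ℂ] A :=
  LinearMap.mkContinuous
    { toFun f := f 1
      map_add' _ _ := rfl
      map_smul' _ _ := rfl } 1 fun f => by
        rw [one_mul]
        exact Cc.norm_apply_one_le f

variable (α) in
/-- The canonical conditional expectation `E : A ⋊_r G → A`, the continuous extension of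
`∑ a_t u_t ↦ a_e`. -/
def condExp : Red α →L[ℂ] A :=
  (evalOne α).extend (Completion.toComplL : Cc α →L[ℂ] Completion (Cc α))

theorem condExp_ofCc (f : Cc α) : condExp α (ofCc α f) = f 1 :=
  (evalOne α).extend_eq (e := (Completion.toComplL : Cc α →L[ℂ] Completion (Cc α)))
    Completion.denseRange_coe (Completion.isUniformInducing_coe _) f

theorem uniformContinuous_map (φ : A →⋆ₙₐ[ℂ] B) (hφ : ∀ t a, φ (α t a) = β t (φ a)) :
    UniformContinuous (Cc.map φ hφ) :=
  AddMonoidHomClass.uniformContinuous_of_bound (Cc.map φ hφ) 1 fun f => by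
    rw [one_mul]; exact Cc.norm_map_le f

/-- Auxiliary function underlying `Red.map`. -/
def mapFun (φ : A →⋆ₙₐ[ℂ] B) (hφ : ∀ t a, φ (α t a) = β t (φ a)) : Red α → Red β :=
  Completion.map (Cc.map φ hφ)

theorem continuous_mapFun (φ : A →⋆ₙₐ[ℂ] B) (hφ : ∀ t a, φ (α t a) = β t (φ a)) :
    Continuous (mapFun φ hφ) :=
  Completion.continuous_map

theorem mapFun_ofCc (φ : A →⋆ₙₐ[ℂ] B) (hφ : ∀ t a, φ (α t a) = β t (φ a)) (f : Cc α) :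
    mapFun φ hφ (ofCc α f) = ofCc β (Cc.map φ hφ f) :=
  Completion.map_coe (uniformContinuous_map φ hφ) f

/-- The `*`-homomorphism `φ ⋊_r id : A ⋊_r G → B ⋊_r G` induced by an equivariant
`*`-homomorphism `φ : A → B`: the continuous extension of `∑ a_t u_t ↦ ∑ φ(a_t) u_t`. -/
def map (φ : A →⋆ₙₐ[ℂ] B) (hφ : ∀ t a, φ (α t a) = β t (φ a)) : Red α →⋆ₙₐ[ℂ] Red β where
  toFun := mapFun φ hφ
  map_smul' c x := by
    have hc := continuous_mapFun φ hφ
    induction x using Red.ind with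
    | hp => exact isClosed_eq (hc.comp (continuous_const_smul c)) ((continuous_const_smul c).comp hc)
    | h f => simp only [← map_smul, mapFun_ofCc]; rfl
  map_zero' := by rw [← map_zero (ofCc α), mapFun_ofCc, map_zero, map_zero]
  map_add' x y := by
    have hc := continuous_mapFun φ hφ
    induction x, y using Red.ind₂ with
    | hp => exact isClosed_eq (hc.comp continuous_add)
              ((hc.comp continuous_fst).add (hc.comp continuous_snd))
    | h f g => simp only [← map_add, mapFun_ofCc]
  map_mul' x y := by
    have hc := continuous_mapFun φ hφ
    induction x, y using Red.ind₂ with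
    | hp => exact isClosed_eq (hc.comp continuous_mul)
              ((hc.comp continuous_fst).mul (hc.comp continuous_snd))
    | h f g => simp only [← map_mul, mapFun_ofCc]
  map_star' x := by
    have hc := continuous_mapFun φ hφ
    induction x using Red.ind with
    | hp => exact isClosed_eq (hc.comp continuous_star) hc.star
    | h f => simp only [← map_star, mapFun_ofCc]

theorem map_ofCc (φ : A →⋆ₙₐ[ℂ] B) (hφ : ∀ t a, φ (α t a) = β t (φ a)) (f : Cc α) :
    map φ hφ (ofCc α f) = ofCc β (Cc.map φ hφ f) :=
  mapFun_ofCc φ hφ f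

end Red

end Reduced
section Ideals

variable {A B : Type*} [NonUnitalCStarAlgebra A] [NonUnitalCStarAlgebra B]

/-- Ideals of a C*-algebra: closed two-sided ideals. -/
structure ClosedIdeal (B : Type*) [NonUnitalCStarAlgebra B] extends Submodule ℂ B where
  mul_mem_left' : ∀ (x : B) {y : B}, y ∈ carrier → x * y ∈ carrier
  mul_mem_right' : ∀ {x : B} (y : B), x ∈ carrier → x * y ∈ carrier
  isClosed' : IsClosed carrier

section Approx

attribute [local instance] CStarAlgebra.spectralOrder CStarAlgebra.spectralOrderedRing

theorem exists_approx (D : NonUnitalStarSubalgebra ℂ B) (hD : IsClosed (D : Set B)) {i : B}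
    (hi : i ∈ D) {ε : ℝ} (hε : 0 < ε) :
    ∃ e ∈ D, star e = e ∧ ‖e‖ ≤ 1 ∧ ‖i - i * e‖ < ε ∧ ‖i - e * i‖ < ε ∧
      (∀ z : B, ‖z - e * z‖ ≤ ‖z‖) ∧ ∀ z : B, ‖z - z * e‖ ≤ ‖z‖ := by
  have := hD
  let : PartialOrder D := CStarAlgebra.spectralOrder D
  have : StarOrderedRing D := CStarAlgebra.spectralOrderedRing D
  have hl := CStarAlgebra.increasingApproximateUnit D
  have h1 := Metric.tendsto_nhds.1 (hl.tendsto_mul_left ⟨i, hi⟩) ε hε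
  have h2 := Metric.tendsto_nhds.1 (hl.tendsto_mul_right ⟨i, hi⟩) ε hε
  obtain ⟨e, he0, he1, h1, h2⟩ :=
    (hl.eventually_nonneg.and (hl.eventually_norm.and (h1.and h2))).exists
  have hs : star (e : B) = e := congrArg Subtype.val he0.isSelfAdjoint.star_eq
  have hn : ∀ z : B, ‖z - e * z‖ ≤ ‖z‖ := by
    intro z
    have h0 : (0 : B) ≤ e := by
      obtain ⟨c, hc⟩ := CStarAlgebra.nonneg_iff_eq_star_mul_self.1 he0
      rw [hc]
      exact star_mul_self_nonneg (c : B)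
    refine CStarAlgebra.norm_sub_mul_self_le_of_inr z le_rfl h0 he1 (norm_nonneg _) ?_
    rw [Unitization.inr_zero, sub_zero, mul_one, CStarRing.norm_star_mul_self,
      Unitization.norm_inr, sq]
  refine ⟨e, e.2, hs, he1, ?_, ?_, hn, fun z => ?_⟩
  · rw [dist_comm, dist_eq_norm] at h1; exact h1
  · rw [dist_comm, dist_eq_norm] at h2; exact h2
  · have := hn (star z)
    rwa [← norm_star, star_sub, star_mul, star_star, hs, norm_star] at this

end Approx

namespace ClosedIdeal

instance : SetLike (ClosedIdeal B) B where
  coe I := I.carrier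
  coe_injective I J h := by
    obtain ⟨I, _⟩ := I
    obtain ⟨J, _⟩ := J
    congr
    exact SetLike.coe_injective h

variable (I : ClosedIdeal B)

theorem ext' {I J : ClosedIdeal B} (h : ∀ x, x ∈ I ↔ x ∈ J) : I = J := SetLike.ext h

theorem mem_toSubmodule {x : B} : x ∈ I.toSubmodule ↔ x ∈ I := Iff.rfl

theorem mul_mem_left (x : B) {y : B} (h : y ∈ I) : x * y ∈ I := I.mul_mem_left' x h

theorem mul_mem_right {x : B} (y : B) (h : x ∈ I) : x * y ∈ I := I.mul_mem_right' y h

theorem isClosed : IsClosed (I : Set B) := I.isClosed'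

instance : AddSubgroupClass (ClosedIdeal B) B where
  add_mem {I} _ _ h₁ h₂ := I.toSubmodule.add_mem h₁ h₂
  zero_mem I := I.toSubmodule.zero_mem
  neg_mem {I} _ h := I.toSubmodule.neg_mem h

instance : NonUnitalSubringClass (ClosedIdeal B) B where
  mul_mem {I} x _ _ h₂ := I.mul_mem_left x h₂

instance : SMulMemClass (ClosedIdeal B) ℂ B where
  smul_mem {I} c _ h := I.toSubmodule.smul_mem c h

theorem mem_of_forall_lt {x : B} (h : ∀ ε > 0, ∃ y ∈ I, ‖x - y‖ < ε) : x ∈ I := by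
  have : x ∈ closure (I : Set B) := Metric.mem_closure_iff.2 fun ε hε => by
    obtain ⟨y, hy, h⟩ := h ε hε
    exact ⟨y, hy, by rwa [dist_eq_norm]⟩
  rwa [I.isClosed.closure_eq] at this

/-- Closed two-sided ideals of C*-algebras are self-adjoint. -/
instance : StarMemClass (ClosedIdeal B) B where
  star_mem {I x} hx := by
    let D : NonUnitalStarSubalgebra ℂ B :=
      { carrier := {y | y ∈ I ∧ star y ∈ I}
        add_mem' := fun h₁ h₂ => ⟨add_mem h₁.1 h₂.1, by rw [star_add]; exact add_mem h₁.2 h₂.2⟩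
        zero_mem' := ⟨zero_mem I, by rw [star_zero]; exact zero_mem I⟩
        mul_mem' := fun h₁ h₂ => ⟨mul_mem h₁.1 h₂.1, by rw [star_mul]; exact mul_mem h₂.2 h₁.2⟩
        smul_mem' := fun c y h =>
          ⟨SMulMemClass.smul_mem c h.1, by rw [star_smul]; exact SMulMemClass.smul_mem _ h.2⟩
        star_mem' := fun h => ⟨h.2, by rw [star_star]; exact h.1⟩ }
    have hD : IsClosed (D : Set B) :=
      I.isClosed.inter (I.isClosed.preimage continuous_star)
    have ha : x * star x ∈ D :=
      ⟨I.mul_mem_right _ hx, by rw [star_mul, star_star]; exact I.mul_mem_right _ hx⟩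
    refine I.mem_of_forall_lt fun ε hε => ?_
    obtain ⟨e, he, hes, -, h1, -, hn, -⟩ := exists_approx D hD ha (pow_pos hε 2)
    refine ⟨star x * e, I.mul_mem_left _ he.1, ?_⟩
    have h2 : ‖star x - star x * e‖ ^ 2 < ε ^ 2 := by
      rw [sq, ← CStarRing.norm_star_mul_self]
      refine lt_of_le_of_lt ?_ h1
      refine le_trans (le_of_eq ?_) (hn _)
      congr 1
      simp only [star_sub, star_mul, star_star, hes]
      noncomm_ring
    exact lt_of_pow_lt_pow_left₀ 2 hε.le h2

instance : IsClosed (I : Set B) := I.isClosed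

instance : IsClosed (I.toSubmodule : Set B) := I.isClosed

/-- A closed ideal is itself a C*-algebra. -/
instance : NonUnitalCStarAlgebra I := NonUnitalStarSubalgebra.nonUnitalCStarAlgebra I

/-- The ideal as a closed `*`-subalgebra. -/
def toSubalg : NonUnitalStarSubalgebra ℂ B where
  carrier := I
  add_mem' := add_mem
  zero_mem' := zero_mem I
  mul_mem' := mul_mem
  smul_mem' c _ h := SMulMemClass.smul_mem c h
  star_mem' := star_mem

/-- The inclusion `ι : I → B`. -/
def subtype : I →⋆ₙₐ[ℂ] B where
  toFun := Subtype.val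
  map_smul' _ _ := rfl
  map_zero' := rfl
  map_add' _ _ := rfl
  map_mul' _ _ := rfl
  map_star' _ := rfl

/-- The quotient `B / I` by a closed ideal, with the quotient norm. -/
def Quot : Type _ := B ⧸ I.toSubmodule

namespace Quot

instance : NormedAddCommGroup I.Quot := inferInstanceAs (NormedAddCommGroup (B ⧸ I.toSubmodule))

instance : NormedSpace ℂ I.Quot := inferInstanceAs (NormedSpace ℂ (B ⧸ I.toSubmodule))

instance : CompleteSpace I.Quot := inferInstanceAs (CompleteSpace (B ⧸ I.toSubmodule))

/-- The class of `x` in `B / I`. -/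
def cls (x : B) : I.Quot := (Submodule.Quotient.mk x : B ⧸ I.toSubmodule)

variable {I}

theorem cls_eq {x y : B} : cls I x = cls I y ↔ x - y ∈ I :=
  Submodule.Quotient.eq I.toSubmodule

theorem ind {p : I.Quot → Prop} (h : ∀ x, p (cls I x)) (q : I.Quot) : p q :=
  Submodule.Quotient.induction_on I.toSubmodule q h

instance : Mul I.Quot where
  mul := Quotient.map₂ (fun x y : B => x * y) fun x x' hx y y' hy => by
    have hx' : x - x' ∈ I := (Submodule.quotientRel_def _).1 hx
    have hy' : y - y' ∈ I := (Submodule.quotientRel_def _).1 hy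
    refine (Submodule.quotientRel_def _).2 ?_
    have : x * y - x' * y' = (x - x') * y + x' * (y - y') := by noncomm_ring
    change x * y - x' * y' ∈ I
    rw [this]
    exact add_mem (I.mul_mem_right _ hx') (I.mul_mem_left _ hy')

instance : Star I.Quot where
  star := Quotient.map (fun x : B => star x) fun x x' hx => by
    have hx' : x - x' ∈ I := (Submodule.quotientRel_def _).1 hx
    refine (Submodule.quotientRel_def _).2 ?_
    change star x - star x' ∈ I
    rw [← star_sub]
    exact star_mem hx'

theorem cls_mul (x y : B) : cls I (x * y) = cls I x * cls I y := rfl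

theorem cls_star (x : B) : cls I (star x) = star (cls I x) := rfl

theorem cls_add (x y : B) : cls I (x + y) = cls I x + cls I y := rfl

theorem cls_smul (c : ℂ) (x : B) : cls I (c • x) = c • cls I x := rfl

theorem cls_zero : cls I 0 = 0 := rfl

theorem norm_cls_le (x : B) : ‖cls I x‖ ≤ ‖x‖ := Submodule.Quotient.norm_mk_le I.toSubmodule x

theorem exists_norm_lt (q : I.Quot) {ε : ℝ} (hε : 0 < ε) : ∃ x, cls I x = q ∧ ‖x‖ < ‖q‖ + ε :=
  Submodule.Quotient.norm_mk_lt (S := I.toSubmodule) q hε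

theorem norm_sq_le (x : B) : ‖cls I x‖ * ‖cls I x‖ ≤ ‖cls I (star x * x)‖ := by
  refine le_of_forall_pos_le_add fun ε hε => ?_
  obtain ⟨q, hq, hqn⟩ := exists_norm_lt (cls I (star x * x)) (half_pos hε)
  have hi : q - star x * x ∈ I := cls_eq.1 hq
  set i := q - star x * x with hi'
  obtain ⟨e, he, hes, -, h1, -, hl, hr⟩ :=
    exists_approx I.toSubalg I.isClosed (i := i) hi (half_pos hε)
  have h2 : cls I x = cls I (x - x * e) := by
    rw [cls_eq, sub_sub_cancel]
    exact I.mul_mem_left x he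
  have h3 : star (x - x * e) * (x - x * e) =
      ((q - q * e) - e * (q - q * e)) - ((i - i * e) - e * (i - i * e)) := by
    have : q = i + star x * x := by rw [hi']; abel
    rw [this, star_sub, star_mul, hes]
    noncomm_ring
  rw [h2]
  calc ‖cls I (x - x * e)‖ * ‖cls I (x - x * e)‖ ≤ ‖x - x * e‖ * ‖x - x * e‖ := by
        gcongr <;> exact norm_cls_le _
    _ = ‖star (x - x * e) * (x - x * e)‖ := CStarRing.norm_star_mul_self.symm
    _ ≤ ‖(q - q * e) - e * (q - q * e)‖ + ‖(i - i * e) - e * (i - i * e)‖ := by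
        rw [h3]; exact norm_sub_le _ _
    _ ≤ ‖q‖ + ‖i - i * e‖ := add_le_add ((hl _).trans (hr _)) (hl _)
    _ ≤ _ := by linarith

instance : NonUnitalCStarAlgebra I.Quot where
  __ : NormedSpace ℂ I.Quot := inferInstance
  left_distrib a b c := by
    induction a using Quot.ind; induction b using Quot.ind; induction c using Quot.ind
    simp only [← cls_mul, ← cls_add, mul_add]
  right_distrib a b c := by
    induction a using Quot.ind; induction b using Quot.ind; induction c using Quot.ind
    simp only [← cls_mul, ← cls_add, add_mul]
  zero_mul a := by
    induction a using Quot.ind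
    rw [← cls_zero, ← cls_mul, zero_mul]
  mul_zero a := by
    induction a using Quot.ind
    rw [← cls_zero, ← cls_mul, mul_zero]
  mul_assoc a b c := by
    induction a using Quot.ind; induction b using Quot.ind; induction c using Quot.ind
    simp only [← cls_mul, mul_assoc]
  dist_eq _ _ := dist_eq_norm_neg_add _ _
  norm_mul_le a b := by
    have key : ∀ δ > 0, ‖a * b‖ ≤ (‖a‖ + δ) * (‖b‖ + δ) := by
      intro δ hδ
      obtain ⟨x, rfl, hx⟩ := exists_norm_lt a hδ
      obtain ⟨y, rfl, hy⟩ := exists_norm_lt b hδ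
      rw [← cls_mul]
      exact (norm_cls_le _).trans ((norm_mul_le x y).trans (by gcongr))
    have hc : Filter.Tendsto (fun δ : ℝ => (‖a‖ + δ) * (‖b‖ + δ)) (nhdsWithin 0 (Set.Ioi 0))
        (nhds ((‖a‖ + 0) * (‖b‖ + 0))) :=
      ((by fun_prop : Continuous fun δ : ℝ => (‖a‖ + δ) * (‖b‖ + δ)).tendsto 0).mono_left
        nhdsWithin_le_nhds
    rw [add_zero, add_zero] at hc
    exact ge_of_tendsto hc (Filter.eventually_of_mem self_mem_nhdsWithin key)
  star_involutive a := by
    induction a using Quot.ind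
    simp only [← cls_star, star_star]
  star_mul a b := by
    induction a using Quot.ind; induction b using Quot.ind
    simp only [← cls_mul, ← cls_star, star_mul]
  star_add a b := by
    induction a using Quot.ind; induction b using Quot.ind
    simp only [← cls_add, ← cls_star, star_add]
  norm_mul_self_le a := by
    induction a using Quot.ind
    exact norm_sq_le _
  smul_assoc c a b := by
    induction a using Quot.ind; induction b using Quot.ind
    simp only [smul_eq_mul, ← cls_mul, ← cls_smul, smul_mul_assoc]
  smul_comm c a b := by
    induction a using Quot.ind; induction b using Quot.ind
    simp only [smul_eq_mul, ← cls_mul, ← cls_smul, mul_smul_comm]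
  star_smul c a := by
    induction a using Quot.ind
    simp only [← cls_star, ← cls_smul, star_smul]

end Quot

/-- The quotient map `ρ : B → B / I`. -/
def quotMk : B →⋆ₙₐ[ℂ] I.Quot where
  toFun := Quot.cls I
  map_smul' _ _ := rfl
  map_zero' := rfl
  map_add' _ _ := rfl
  map_mul' _ _ := rfl
  map_star' _ := rfl

/-- `Ideal[S]`: the smallest (closed, two-sided) ideal containing `S`. -/
def gen (S : Set B) : ClosedIdeal B where
  carrier := {x | ∀ J : ClosedIdeal B, S ⊆ J → x ∈ J}
  add_mem' h₁ h₂ J hJ := add_mem (h₁ J hJ) (h₂ J hJ)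
  zero_mem' J _ := zero_mem J
  smul_mem' c _ h J hJ := SMulMemClass.smul_mem c (h J hJ)
  mul_mem_left' x _ h J hJ := J.mul_mem_left x (h J hJ)
  mul_mem_right' y h J hJ := J.mul_mem_right y (h J hJ)
  isClosed' := by
    simp only [Set.ofPred_forall]
    exact isClosed_iInter fun J => isClosed_iInter fun _ => J.isClosed

theorem subset_gen (S : Set B) : S ⊆ gen S := fun _ hx _ hJ => hJ hx

theorem gen_le {S : Set B} {J : ClosedIdeal B} (h : S ⊆ J) {x : B} (hx : x ∈ gen S) : x ∈ J :=
  hx J h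

end ClosedIdeal

end Ideals

section Dynamics

variable {A : Type u} [NonUnitalCStarAlgebra A] {G : Type v} [Group G]

namespace ClosedIdeal

/-- Invariance of an ideal of `A` under the action `α`. -/
def Invariant (α : G →* (A ≃⋆ₐ[ℂ] A)) (I : ClosedIdeal A) : Prop :=
  ∀ (t : G) {a : A}, a ∈ I → α t a ∈ I

variable {α : G →* (A ≃⋆ₐ[ℂ] A)} {I : ClosedIdeal A}

/-- The restriction of the action to an invariant ideal. -/
def restrict (hI : I.Invariant α) : G →* (I ≃⋆ₐ[ℂ] I) where
  toFun t :=
    { toFun := fun x => ⟨α t x, hI t x.2⟩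
      invFun := fun x => ⟨α t⁻¹ x, hI t⁻¹ x.2⟩
      left_inv := fun x => Subtype.ext (Cc.alpha_inv t (x : A))
      right_inv := fun x => Subtype.ext (Cc.alpha_inv' t (x : A))
      map_mul' := fun x y => Subtype.ext (map_mul (α t) (x : A) y)
      map_add' := fun x y => Subtype.ext (map_add (α t) (x : A) y)
      map_star' := fun x => Subtype.ext (map_star (α t) (x : A))
      map_smul' := fun c x => Subtype.ext (map_smul (α t) c (x : A)) }
  map_one' := StarAlgEquiv.ext fun x => Subtype.ext (Cc.alpha_one (α := α) (x : A))
  map_mul' s t := StarAlgEquiv.ext fun x => Subtype.ext (Cc.alpha_mul (α := α) s t (x : A))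

/-- Auxiliary function: `[a] ↦ [α_t(a)]` on `A / I`. -/
def quotFun (hI : I.Invariant α) (t : G) : I.Quot → I.Quot :=
  Quotient.map (fun x : A => α t x) fun x x' hx => by
    have hx' : x - x' ∈ I := (Submodule.quotientRel_def _).1 hx
    refine (Submodule.quotientRel_def _).2 ?_
    change α t x - α t x' ∈ I
    rw [← map_sub]
    exact hI t hx'

theorem quotFun_cls (hI : I.Invariant α) (t : G) (x : A) :
    quotFun hI t (Quot.cls I x) = Quot.cls I (α t x) := rfl

/-- The action induced on the quotient by an invariant ideal, `t.[a] = [α_t(a)]`. -/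
def induced (hI : I.Invariant α) : G →* (I.Quot ≃⋆ₐ[ℂ] I.Quot) where
  toFun t :=
    { toFun := quotFun hI t
      invFun := quotFun hI t⁻¹
      left_inv := Quot.ind fun x => by rw [quotFun_cls, quotFun_cls, Cc.alpha_inv]
      right_inv := Quot.ind fun x => by rw [quotFun_cls, quotFun_cls, Cc.alpha_inv']
      map_mul' := Quot.ind fun x => Quot.ind fun y => by
        simp only [quotFun_cls, ← Quot.cls_mul, map_mul (α t)]
      map_add' := Quot.ind fun x => Quot.ind fun y => by
        simp only [quotFun_cls, ← Quot.cls_add, map_add (α t)]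
      map_star' := Quot.ind fun x => by
        simp only [quotFun_cls, ← Quot.cls_star, map_star (α t)]
      map_smul' := fun c => Quot.ind fun x => by
        simp only [quotFun_cls, ← Quot.cls_smul, map_smul (α t)] }
  map_one' := StarAlgEquiv.ext <| Quot.ind fun x => congrArg (Quot.cls I) (Cc.alpha_one x)
  map_mul' s t := StarAlgEquiv.ext <| Quot.ind fun x => congrArg (Quot.cls I) (Cc.alpha_mul s t x)

/-- `ι ⋊_r id : I ⋊_r G → A ⋊_r G`. -/
def redSubtype (hI : I.Invariant α) : Red (restrict hI) →⋆ₙₐ[ℂ] Red α :=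
  Red.map I.subtype fun _ _ => rfl

/-- `ρ ⋊_r id : A ⋊_r G → (A / I) ⋊_r G`. -/
def redMk (hI : I.Invariant α) : Red α →⋆ₙₐ[ℂ] Red (induced hI) :=
  Red.map I.quotMk fun _ _ => rfl

end ClosedIdeal

variable (α : G →* (A ≃⋆ₐ[ℂ] A))

/-- The invariant ideals of `A`. -/
def InvIdeal : Type u := {I : ClosedIdeal A // I.Invariant α}

/-- The ideal `J ∩ A` of `A`, for an ideal `J` of `A ⋊_r G`. -/
def interIdeal (J : ClosedIdeal (Red α)) : ClosedIdeal A where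
  carrier := {a | Red.incl α a ∈ J}
  add_mem' {a b} h₁ h₂ := by
    change Red.incl α (a + b) ∈ J
    rw [map_add]; exact add_mem h₁ h₂
  zero_mem' := by
    change Red.incl α 0 ∈ J
    rw [map_zero]; exact zero_mem J
  smul_mem' c a h := by
    change Red.incl α (c • a) ∈ J
    rw [map_smul]; exact SMulMemClass.smul_mem c h
  mul_mem_left' a b h := by
    change Red.incl α (a * b) ∈ J
    rw [map_mul]; exact J.mul_mem_left _ h
  mul_mem_right' {a} b h := by
    change Red.incl α (a * b) ∈ J
    rw [map_mul]; exact J.mul_mem_right _ h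
  isClosed' := J.isClosed.preimage (Red.isometry_incl (α := α)).continuous

theorem mem_interIdeal {J : ClosedIdeal (Red α)} {a : A} :
    a ∈ interIdeal α J ↔ Red.incl α a ∈ J := Iff.rfl

theorem interIdeal_invariant (J : ClosedIdeal (Red α)) : (interIdeal α J).Invariant α := by
  intro t b hb
  have key : ∀ a c : A, α t (a * b * c) ∈ interIdeal α J := by
    intro a c
    have h : Red.incl α (α t (a * b * c)) =
        Red.ofCc α (Cc.single α t (α t a)) * Red.incl α b *
          Red.ofCc α (Cc.single α t⁻¹ c) := by
      change Red.ofCc α _ = _ * Red.ofCc α _ * _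
      rw [← map_mul, ← map_mul, Cc.single_mul_single, Cc.single_mul_single, mul_one,
        mul_inv_cancel, map_mul (α t), map_mul (α t)]
    change Red.incl α _ ∈ J
    rw [h]
    exact J.mul_mem_right _ (J.mul_mem_left _ hb)
  refine (interIdeal α J).mem_of_forall_lt fun ε hε => ?_
  obtain ⟨e, -, -, he, h1, h2, -, -⟩ :=
    exists_approx (interIdeal α J).toSubalg (interIdeal α J).isClosed hb (half_pos hε)
  refine ⟨α t (e * b * e), key e e, ?_⟩
  rw [← map_sub]
  refine (NonUnitalStarAlgHom.norm_apply_le (α t) _).trans_lt ?_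
  have h3 : b - e * b * e = (b - b * e) + (b - e * b) * e := by noncomm_ring
  rw [h3]
  calc _ ≤ ‖b - b * e‖ + ‖b - e * b‖ * ‖e‖ := norm_add_le_of_le le_rfl (norm_mul_le _ _)
    _ ≤ ‖b - b * e‖ + ‖b - e * b‖ * 1 := by gcongr
    _ < ε := by linarith

/-- The map `J ↦ J ∩ A` from the ideals of `A ⋊_r G` to the invariant ideals of `A`. -/
def inter (J : ClosedIdeal (Red α)) : InvIdeal α := ⟨interIdeal α J, interIdeal_invariant α J⟩

/-- `A` separates the ideals in `A ⋊_r G`: the map `J ↦ J ∩ A` is injective. -/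
def SeparatesIdeals : Prop := Function.Injective (inter α)

/-- The action is exact: for every invariant ideal `I` of `A` the sequence
`0 → I ⋊_r G → A ⋊_r G → (A / I) ⋊_r G → 0` is exact. -/
def IsExactAction : Prop :=
  ∀ (I : ClosedIdeal A) (hI : I.Invariant α),
    Function.Injective (ClosedIdeal.redSubtype hI) ∧
    Function.Exact (ClosedIdeal.redSubtype hI) (ClosedIdeal.redMk hI) ∧
    Function.Surjective (ClosedIdeal.redMk hI)

/-- The intersection property: every non-zero ideal of `A ⋊_r G` has non-zero intersection
with `A`. -/
def IntersectionProperty : Prop :=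
  ∀ J : ClosedIdeal (Red α), (∃ x ∈ J, x ≠ 0) → ∃ a ∈ interIdeal α J, a ≠ 0

/-- The residual intersection property: the induced action on `A / I` has the intersection
property for every invariant ideal `I` of `A`. -/
def ResidualIntersectionProperty : Prop :=
  ∀ (I : ClosedIdeal A) (hI : I.Invariant α), IntersectionProperty (ClosedIdeal.induced hI)

/-- `E(x) ∈ Ideal[x]` for every positive `x` in `A ⋊_r G`, where the positive elements of a
C*-algebra are those of the form `y^* y`. -/
def CondExpMemIdeal : Prop :=
  ∀ x : Red α, (∃ y : Red α, x = star y * y) →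
    Red.incl α (Red.condExp α x) ∈ ClosedIdeal.gen {x}

end Dynamics

end

end CStarDynamics

/-!
The proof attaches two ideals of `A ⋊_r G` to an invariant ideal `I` of `A`: the image of
`I ⋊_r G` (`redRange`) and the kernel of `A ⋊_r G → (A / I) ⋊_r G` (`ker (redMk hI)`). Both
intersect `A` in `I`, and the image is contained in every ideal that contains `I`. The first and
last maps of the sequence are always injective and surjective, so exactness of the action says
that the two ideals coincide.

* If `A` separates ideals, the two ideals coincide, whence exactness. Moreover `J = Ideal[x]` is
  the kernel for `I = J ∩ A`. By naturality of the conditional expectation (`Red.condExp_map`),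
  `E` maps that kernel to `I`, so `E(x) ∈ J`.
* Suppose that `E(x) ∈ Ideal[x]` for positive `x`. For a non-zero `y` in an ideal of
  `(A / I) ⋊_r G`, lift `y` to `z`. Then `E(z^* z)` lies in the preimage of the ideal, so the ideal
  contains `E(y^* y)`, which is not zero because `E` is faithful
  (`Red.eq_zero_of_condExp_star_mul_self`). This is the residual intersection property.
* Given exactness and the residual intersection property, let `J` be an ideal and `I = J ∩ A`. Then
  `J` contains the image of `I ⋊_r G`, which is the kernel. The image of `J` in `(A / I) ⋊_r G` is
  therefore an ideal that meets `A / I` in zero, so it vanishes and `J` is equal to the kernel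
  (`mem_iff_redMk_eq_zero`). Thus `J` is determined by `I`.

Faithfulness of `E` is proved by extending the norm of the Hilbert module `ℓ²(G, A)` to the seminorm
`‖E(x^* x)‖^{1/2}` on `A ⋊_r G`. If it vanishes at `x`, it vanishes at all products `x (a u_s)`, and
hence the operator norm of `x` on `ℓ²(G, A)` is zero.
-/

namespace CStarDynamics

/-! ### Faithfulness of the canonical conditional expectation -/

section Faithful

variable {A : Type*} [NonUnitalCStarAlgebra A] {G : Type*} [Group G]
  {α : G →* (A ≃⋆ₐ[ℂ] A)}

namespace Red

/-- The extension of the Hilbert module norm of `ℓ²(G, A)` to the reduced crossed product: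
`‖x‖₂ = ‖E(x^* x)‖^{1/2}`. -/
noncomputable def l2norm (x : Red α) : ℝ := √‖condExp α (star x * x)‖

theorem continuous_l2norm : Continuous (l2norm : Red α → ℝ) := by
  unfold l2norm
  fun_prop

theorem l2norm_ofCc (f : Cc α) : l2norm (ofCc α f) = Cc.l2norm f := by
  rw [l2norm, ← map_star, ← map_mul, condExp_ofCc, Cc.l2norm, Cc.ip_eq]

theorem l2norm_add_le (x y : Red α) : l2norm (x + y) ≤ l2norm x + l2norm y := by
  have hc : Continuous (l2norm : Red α → ℝ) := continuous_l2norm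
  induction x, y using Red.ind₂ with
  | hp => exact isClosed_le (by fun_prop) (by fun_prop)
  | h f g =>
    rw [← map_add, l2norm_ofCc, l2norm_ofCc, l2norm_ofCc]
    exact Cc.l2norm_add_le f g

theorem l2norm_mul_ofCc_le (x : Red α) (ξ : Cc α) :
    l2norm (x * ofCc α ξ) ≤ ‖x‖ * Cc.l2norm ξ := by
  have hc : Continuous (l2norm : Red α → ℝ) := continuous_l2norm
  induction x using Red.ind with
  | hp => exact isClosed_le (by fun_prop) (by fun_prop)
  | h f =>
    rw [← map_mul, l2norm_ofCc, norm_ofCc]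
    exact Cc.l2norm_mul_le f ξ

theorem condExp_conj_single (x : Red α) (s : G) (b : A) :
    condExp α (star (ofCc α (Cc.single α s b)) * (x * ofCc α (Cc.single α s b))) =
      α s⁻¹ (star b * condExp α x * b) := by
  have hs : Continuous (α s⁻¹) := StarAlgEquiv.isometry (α s⁻¹) |>.continuous
  induction x using Red.ind with
  | hp => exact isClosed_eq (by fun_prop) (by fun_prop)
  | h f =>
    rw [← map_star, ← map_mul, ← map_mul, condExp_ofCc, condExp_ofCc,
      Cc.star_single_mul_mul_single]

theorem l2norm_mul_ofCc_eq_zero {x : Red α} (hx : condExp α (star x * x) = 0) (ξ : Cc α) :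
    l2norm (x * ofCc α ξ) = 0 := by
  refine le_antisymm ?_ (Real.sqrt_nonneg _)
  induction ξ using Cc.ind with
  | h0 => simp [l2norm]
  | ha f g hf hg =>
    rw [map_add, mul_add]
    exact (l2norm_add_le _ _).trans (by linarith)
  | hs s b =>
    have h := condExp_conj_single (star x * x) s b
    rw [hx, mul_zero, zero_mul, map_zero] at h
    rw [l2norm, star_mul, mul_assoc, ← mul_assoc (star x), h, norm_zero, Real.sqrt_zero]

/-- The canonical conditional expectation is faithful. -/
theorem eq_zero_of_condExp_star_mul_self {x : Red α} (hx : condExp α (star x * x) = 0) :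
    x = 0 := by
  rw [← norm_le_zero_iff]
  refine le_of_forall_pos_le_add fun ε hε => ?_
  obtain ⟨f, hf⟩ := Metric.denseRange_iff.1 (denseRange_ofCc (α := α)) x (ε / 2) (half_pos hε)
  rw [dist_eq_norm] at hf
  have h : ‖ofCc α f‖ ≤ ε / 2 := by
    rw [norm_ofCc]
    refine Cc.norm_le_of (half_pos hε).le fun ξ => ?_
    have h1 : ofCc α (f * ξ) = x * ofCc α ξ + (ofCc α f - x) * ofCc α ξ := by
      rw [map_mul]; noncomm_ring
    rw [← l2norm_ofCc (f * ξ), h1]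
    refine (l2norm_add_le _ _).trans ?_
    rw [l2norm_mul_ofCc_eq_zero hx, zero_add]
    refine (l2norm_mul_ofCc_le _ _).trans ?_
    rw [norm_sub_rev]
    exact mul_le_mul_of_nonneg_right hf.le (Cc.l2norm_nonneg ξ)
  have := norm_le_norm_add_norm_sub' x (ofCc α f)
  linarith

end Red

end Faithful

/-! ### Functoriality of the reduced crossed product -/

section Functoriality

variable {A B : Type*} [NonUnitalCStarAlgebra A] [NonUnitalCStarAlgebra B]
  {G : Type*} [Group G] {α : G →* (A ≃⋆ₐ[ℂ] A)} {β : G →* (B ≃⋆ₐ[ℂ] B)}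
  {φ : A →⋆ₙₐ[ℂ] B} {hφ : ∀ t a, φ (α t a) = β t (φ a)}

theorem continuous_starHom (φ : A →⋆ₙₐ[ℂ] B) : Continuous φ :=
  AddMonoidHomClass.continuous_of_bound φ 1 fun a => by
    rw [one_mul]; exact NonUnitalStarAlgHom.norm_apply_le φ a

namespace Cc

theorem map_single (t : G) (a : A) : map φ hφ (single α t a) = single β t (φ a) :=
  mapAdd_single φ t a

theorem l2norm_map (h : Function.Injective φ) (ξ : Cc α) : l2norm (map φ hφ ξ) = l2norm ξ := by
  rw [l2norm, l2norm, ip_eq, ip_eq, ← map_star, ← map_mul, map_apply,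
    NonUnitalStarAlgHom.norm_map φ h]

/-- An injective equivariant `*`-homomorphism induces an isometry for the reduced norms: vectors
with coefficients in the smaller algebra already see the norm. -/
theorem norm_map (h : Function.Injective φ) (f : Cc α) : ‖map φ hφ f‖ = ‖f‖ := by
  refine le_antisymm (norm_map_le f) (norm_le_of (norm_nonneg _) fun ξ => ?_)
  rw [← l2norm_map (hφ := hφ) h, ← l2norm_map (hφ := hφ) h ξ, map_mul]
  exact l2norm_mul_le _ _

theorem map_surjective (h : Function.Surjective φ) : Function.Surjective (map φ hφ) := by
  intro f
  induction f using Cc.ind with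
  | h0 => exact ⟨0, map_zero _⟩
  | ha f g hf hg =>
    obtain ⟨f, rfl⟩ := hf
    obtain ⟨g, rfl⟩ := hg
    exact ⟨f + g, map_add _ _ _⟩
  | hs t b =>
    obtain ⟨a, rfl⟩ := h b
    exact ⟨single α t a, map_single t a⟩

end Cc

namespace Red

theorem map_incl (a : A) : map φ hφ (incl α a) = incl β (φ a) := by
  change map φ hφ (ofCc α _) = ofCc β _
  rw [map_ofCc, Cc.map_single]

theorem condExp_incl (a : A) : condExp α (incl α a) = a := by
  change condExp α (ofCc α _) = _
  rw [condExp_ofCc, Cc.single_self]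

/-- Naturality of the canonical conditional expectation. -/
theorem condExp_map (x : Red α) : condExp β (map φ hφ x) = φ (condExp α x) := by
  have h1 : Continuous (map φ hφ) := continuous_starHom _
  have h2 : Continuous φ := continuous_starHom φ
  induction x using Red.ind with
  | hp => exact isClosed_eq (by fun_prop) (by fun_prop)
  | h f => rw [map_ofCc, condExp_ofCc, condExp_ofCc, Cc.map_apply]

theorem norm_map (h : Function.Injective φ) (x : Red α) : ‖map φ hφ x‖ = ‖x‖ := by
  have h1 : Continuous (map φ hφ) := continuous_starHom _
  induction x using Red.ind with
  | hp => exact isClosed_eq (by fun_prop) (by fun_prop)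
  | h f => rw [map_ofCc, norm_ofCc, norm_ofCc, Cc.norm_map h]

theorem isometry_map (h : Function.Injective φ) : Isometry (map φ hφ) :=
  AddMonoidHomClass.isometry_of_norm _ (norm_map h)

theorem denseRange_map (h : Function.Surjective φ) : DenseRange (map φ hφ) := by
  refine Dense.mono ?_ (denseRange_ofCc (α := β))
  rintro _ ⟨f, rfl⟩
  obtain ⟨g, rfl⟩ := Cc.map_surjective (hφ := hφ) h f
  exact ⟨ofCc α g, map_ofCc _ _ g⟩

end Red

end Functoriality

/-! ### Ideals and `*`-homomorphisms -/

section Ideals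

variable {A B : Type*} [NonUnitalCStarAlgebra A] [NonUnitalCStarAlgebra B]

namespace ClosedIdeal

/-- The preimage of a closed ideal under a `*`-homomorphism. -/
def comap (φ : A →⋆ₙₐ[ℂ] B) (J : ClosedIdeal B) : ClosedIdeal A where
  carrier := {x | φ x ∈ J}
  add_mem' {x y} hx hy := by
    change φ (x + y) ∈ J
    rw [map_add]; exact add_mem hx hy
  zero_mem' := by
    change φ 0 ∈ J
    rw [map_zero]; exact zero_mem J
  smul_mem' c x hx := by
    change φ (c • x) ∈ J
    rw [map_smul]; exact SMulMemClass.smul_mem c hx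
  mul_mem_left' x y hy := by
    change φ (x * y) ∈ J
    rw [map_mul]; exact J.mul_mem_left _ hy
  mul_mem_right' {x} y hx := by
    change φ (x * y) ∈ J
    rw [map_mul]; exact J.mul_mem_right _ hx
  isClosed' := J.isClosed.preimage (continuous_starHom φ)

/-- The kernel of a `*`-homomorphism. -/
def ker (φ : A →⋆ₙₐ[ℂ] B) : ClosedIdeal A where
  carrier := {x | φ x = 0}
  add_mem' {x y} hx hy := by
    change φ (x + y) = 0
    rw [map_add, hx, hy, add_zero]
  zero_mem' := map_zero φ
  smul_mem' c x hx := by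
    change φ (c • x) = 0
    rw [map_smul, hx, smul_zero]
  mul_mem_left' x y hy := by
    change φ (x * y) = 0
    rw [map_mul, hy, mul_zero]
  mul_mem_right' {x} y hx := by
    change φ (x * y) = 0
    rw [map_mul, hx, zero_mul]
  isClosed' := isClosed_singleton.preimage (continuous_starHom φ)

theorem mem_ker {φ : A →⋆ₙₐ[ℂ] B} {x : A} : x ∈ ker φ ↔ φ x = 0 := Iff.rfl

/-- Auxiliary function underlying `quotKer`. -/
def quotKerFun (φ : A →⋆ₙₐ[ℂ] B) : (ker φ).Quot → B :=
  Quotient.lift φ fun x y hxy => by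
    have h : φ (x - y) = 0 := (Submodule.quotientRel_def _).1 hxy
    rwa [map_sub, sub_eq_zero] at h

/-- The injective `*`-homomorphism on the quotient by the kernel. -/
def quotKer (φ : A →⋆ₙₐ[ℂ] B) : (ker φ).Quot →⋆ₙₐ[ℂ] B where
  toFun := quotKerFun φ
  map_smul' c := Quot.ind fun x => map_smul φ c x
  map_zero' := map_zero φ
  map_add' := Quot.ind fun x => Quot.ind fun y => map_add φ x y
  map_mul' := Quot.ind fun x => Quot.ind fun y => map_mul φ x y
  map_star' := Quot.ind fun x => map_star φ x

theorem quotKer_injective (φ : A →⋆ₙₐ[ℂ] B) : Function.Injective (quotKer φ) := by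
  refine (injective_iff_map_eq_zero _).2 (Quot.ind fun x hx => ?_)
  rw [← Quot.cls_zero, Quot.cls_eq, sub_zero]
  exact hx

/-- The range of a `*`-homomorphism of C*-algebras is closed, because it is the range of the
isometry `quotKer φ`. -/
theorem isClosed_range (φ : A →⋆ₙₐ[ℂ] B) : IsClosed (Set.range φ) := by
  have h : Set.range φ = Set.range (quotKer φ) := by
    ext y
    constructor
    · rintro ⟨x, rfl⟩; exact ⟨Quot.cls _ x, rfl⟩
    · rintro ⟨q, rfl⟩
      induction q using Quot.ind with
      | h x => exact ⟨x, rfl⟩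
  rw [h]
  exact (AddMonoidHomClass.isometry_of_norm _
    (NonUnitalStarAlgHom.norm_map _ (quotKer_injective φ))).isClosedEmbedding.isClosed_range

/-- The image under a surjective `*`-homomorphism of an ideal that contains the kernel. It is
closed by the open mapping theorem. -/
def mapOfSurjective (φ : A →⋆ₙₐ[ℂ] B) (hφ : Function.Surjective φ) (J : ClosedIdeal A)
    (hJ : ∀ x, φ x = 0 → x ∈ J) : ClosedIdeal B where
  carrier := φ '' J
  add_mem' := by
    rintro _ _ ⟨x, hx, rfl⟩ ⟨y, hy, rfl⟩
    exact ⟨x + y, add_mem hx hy, map_add φ x y⟩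
  zero_mem' := ⟨0, zero_mem J, map_zero φ⟩
  smul_mem' := by
    rintro c _ ⟨x, hx, rfl⟩
    exact ⟨c • x, SMulMemClass.smul_mem c hx, map_smul φ c x⟩
  mul_mem_left' := by
    rintro z _ ⟨y, hy, rfl⟩
    obtain ⟨x, rfl⟩ := hφ z
    exact ⟨x * y, J.mul_mem_left x hy, map_mul φ x y⟩
  mul_mem_right' := by
    rintro _ z ⟨x, hx, rfl⟩
    obtain ⟨y, rfl⟩ := hφ z
    exact ⟨x * y, J.mul_mem_right y hx, map_mul φ x y⟩
  isClosed' := by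
    let f : A →L[ℂ] B := ⟨(φ : A →ₗ[ℂ] B), continuous_starHom φ⟩
    have hf : Topology.IsQuotientMap f := f.isQuotientMap hφ
    refine hf.isClosed_preimage.1 ?_
    have h : f ⁻¹' (φ '' (J : Set A)) = J := by
      ext x
      constructor
      · rintro ⟨y, hy, hxy⟩
        have h1 : x - y ∈ J := hJ _ (by rw [map_sub, hxy]; exact sub_self _)
        exact sub_add_cancel x y ▸ add_mem h1 hy
      · exact fun hx => ⟨x, hx, rfl⟩
    change IsClosed (f ⁻¹' (φ '' (J : Set A)))
    rw [h]
    exact J.isClosed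

end ClosedIdeal

end Ideals

/-! ### The ideals attached to an invariant ideal, and the equivalences -/

section Dynamics

variable {A : Type*} [NonUnitalCStarAlgebra A] {G : Type*} [Group G]
  {α : G →* (A ≃⋆ₐ[ℂ] A)}

namespace ClosedIdeal

variable {I : ClosedIdeal A} (hI : I.Invariant α)

theorem redMk_surjective : Function.Surjective (redMk hI) := by
  have hd : DenseRange (redMk hI) :=
    Red.denseRange_map (Quot.ind fun x => ⟨x, rfl⟩)
  rw [← Set.range_eq_univ, ← (isClosed_range (redMk hI)).closure_eq]
  exact hd.closure_range

theorem redSubtype_isometry : Isometry (redSubtype hI) :=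
  Red.isometry_map Subtype.val_injective

theorem redMk_incl (a : A) :
    redMk hI (Red.incl α a) = Red.incl (induced hI) (Quot.cls I a) :=
  Red.map_incl a

theorem redMk_incl_eq_zero {a : A} : redMk hI (Red.incl α a) = 0 ↔ a ∈ I := by
  rw [redMk_incl, ← norm_eq_zero, Red.norm_incl, norm_eq_zero, ← Quot.cls_zero, Quot.cls_eq, sub_zero]

theorem condExp_redMk (x : Red α) :
    Red.condExp (induced hI) (redMk hI x) = Quot.cls I (Red.condExp α x) :=
  Red.condExp_map x

theorem condExp_mem_of_redMk_eq_zero {x : Red α} (hx : redMk hI x = 0) :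
    Red.condExp α x ∈ I := by
  have h := condExp_redMk hI x
  rwa [hx, map_zero, eq_comm, ← Quot.cls_zero, Quot.cls_eq, sub_zero] at h

theorem redSubtype_ofCc_single (t : G) (a : I) :
    redSubtype hI (Red.ofCc _ (Cc.single (restrict hI) t a)) =
      Red.ofCc α (Cc.single α t a) :=
  (Red.map_ofCc _ _ _).trans (congrArg _ (Cc.map_single t a))

theorem ofCc_single_mem_range {a : A} (ha : a ∈ I) (t : G) :
    Red.ofCc α (Cc.single α t a) ∈ Set.range (redSubtype hI) :=
  ⟨Red.ofCc _ (Cc.single (restrict hI) t ⟨a, ha⟩),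
    redSubtype_ofCc_single hI t ⟨a, ha⟩⟩

/-- To verify a closed additive condition on `I ⋊_r G`, it suffices to consider `a u_t` with
`a ∈ I`. -/
theorem redSubtype_ind {p : Red α → Prop} (hp : IsClosed {x | p x}) (h0 : p 0)
    (hadd : ∀ x y, p x → p y → p (x + y))
    (hs : ∀ t, ∀ a ∈ I, p (Red.ofCc α (Cc.single α t a))) (x : Red (restrict hI)) :
    p (redSubtype hI x) := by
  induction x using Red.ind with
  | hp => exact hp.preimage (redSubtype_isometry hI).continuous
  | h f =>
    induction f using Cc.ind with
    | h0 => simpa only [map_zero] using h0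
    | ha f g hf hg => simpa only [map_add] using hadd _ _ hf hg
    | hs t a => rw [redSubtype_ofCc_single]; exact hs t a a.2

theorem isClosed_range_redSubtype : IsClosed (Set.range (redSubtype hI)) :=
  (redSubtype_isometry hI).isClosedEmbedding.isClosed_range

theorem add_mem_range_redSubtype {x y : Red α} (hx : x ∈ Set.range (redSubtype hI))
    (hy : y ∈ Set.range (redSubtype hI)) : x + y ∈ Set.range (redSubtype hI) := by
  obtain ⟨x, rfl⟩ := hx
  obtain ⟨y, rfl⟩ := hy
  exact ⟨x + y, map_add _ x y⟩

theorem zero_mem_range_redSubtype : (0 : Red α) ∈ Set.range (redSubtype hI) :=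
  ⟨0, map_zero _⟩

/-- The ideal `I ⋊_r G` of `A ⋊_r G`. -/
def redRange : ClosedIdeal (Red α) where
  carrier := Set.range (redSubtype hI)
  add_mem' := add_mem_range_redSubtype hI
  zero_mem' := zero_mem_range_redSubtype hI
  smul_mem' := by
    rintro c _ ⟨x, rfl⟩
    exact ⟨c • x, map_smul _ c x⟩
  mul_mem_left' y z hz := by
    obtain ⟨x, rfl⟩ := hz
    refine redSubtype_ind hI (p := fun z => y * z ∈ Set.range (redSubtype hI))
      ((isClosed_range_redSubtype hI).preimage (continuous_const_mul y)) ?_ ?_ ?_ x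
    · rw [mul_zero]; exact zero_mem_range_redSubtype hI
    · intro z w hz hw
      rw [mul_add]; exact add_mem_range_redSubtype hI hz hw
    · intro t a ha
      induction y using Red.ind with
      | hp => exact (isClosed_range_redSubtype hI).preimage (continuous_mul_const _)
      | h f =>
        induction f using Cc.ind with
        | h0 => rw [map_zero, zero_mul]; exact zero_mem_range_redSubtype hI
        | ha f g hf hg => rw [map_add, add_mul]; exact add_mem_range_redSubtype hI hf hg
        | hs s b =>
          rw [← map_mul, Cc.single_mul_single]
          exact ofCc_single_mem_range hI (I.mul_mem_left b (hI s ha)) _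
  mul_mem_right' {z} y hz := by
    obtain ⟨x, rfl⟩ := hz
    refine redSubtype_ind hI (p := fun z => z * y ∈ Set.range (redSubtype hI))
      ((isClosed_range_redSubtype hI).preimage (continuous_mul_const y)) ?_ ?_ ?_ x
    · rw [zero_mul]; exact zero_mem_range_redSubtype hI
    · intro z w hz hw
      rw [add_mul]; exact add_mem_range_redSubtype hI hz hw
    · intro t a ha
      induction y using Red.ind with
      | hp => exact (isClosed_range_redSubtype hI).preimage (continuous_const_mul _)
      | h f =>
        induction f using Cc.ind with
        | h0 => rw [map_zero, mul_zero]; exact zero_mem_range_redSubtype hI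
        | ha f g hf hg => rw [map_add, mul_add]; exact add_mem_range_redSubtype hI hf hg
        | hs s b =>
          rw [← map_mul, Cc.single_mul_single]
          exact ofCc_single_mem_range hI (I.mul_mem_right _ ha) _
  isClosed' := isClosed_range_redSubtype hI

theorem mem_redRange {x : Red α} : x ∈ redRange hI ↔ x ∈ Set.range (redSubtype hI) := Iff.rfl

theorem interIdeal_redRange : interIdeal α (redRange hI) = I := by
  refine ext' fun a => ?_
  rw [mem_interIdeal, mem_redRange]
  refine ⟨?_, fun ha => ofCc_single_mem_range hI ha 1⟩
  rintro ⟨x, hx⟩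
  have h : Red.condExp α (redSubtype hI x) = I.subtype (Red.condExp _ x) := Red.condExp_map x
  rw [hx, Red.condExp_incl] at h
  rw [h]
  exact (Red.condExp _ x).2

theorem interIdeal_ker_redMk : interIdeal α (ker (redMk hI)) = I :=
  ext' fun _ => redMk_incl_eq_zero hI

/-- An ideal of `A ⋊_r G` that contains `I` contains `I ⋊_r G`. -/
theorem redSubtype_mem {J : ClosedIdeal (Red α)} (hJ : ∀ a ∈ I, Red.incl α a ∈ J)
    (x : Red (restrict hI)) : redSubtype hI x ∈ J := by
  refine redSubtype_ind hI (p := fun z => z ∈ J) J.isClosed (zero_mem J)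
    (fun _ _ => add_mem) (fun t a ha => ?_) x
  refine J.mem_of_forall_lt fun ε hε => ?_
  -- In general `u_t ∉ A ⋊_r G`, so `a u_t` is obtained as a limit of elements `e (a u_t)` with
  -- `e` from an approximate unit of `I`.
  obtain ⟨e, he, -, -, -, h1, -, -⟩ := exists_approx I.toSubalg I.isClosed ha hε
  refine ⟨Red.incl α e * Red.ofCc α (Cc.single α t a), J.mul_mem_right _ (hJ e he), ?_⟩
  have h2 : Red.ofCc α (Cc.single α t a) - Red.incl α e * Red.ofCc α (Cc.single α t a) =
      Red.ofCc α (Cc.single α t (a - e * a)) := by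
    change _ - Red.ofCc α (Cc.single α 1 e) * _ = _
    rw [← map_mul, Cc.single_mul_single, one_mul, Cc.alpha_one, ← map_sub]
    congr 1
    exact (Finsupp.single_sub t a (e * a)).symm
  rw [h2, Red.norm_ofCc]
  refine lt_of_le_of_lt (Cc.norm_le_of (norm_nonneg (a - e * a)) fun ξ => ?_) h1
  refine (Cc.l2norm_single_mul_le t _ ξ).trans ?_
  gcongr
  · exact Cc.l2norm_nonneg ξ
  · refine Real.sqrt_le_iff.2 ⟨norm_nonneg _, ?_⟩
    refine (NonUnitalStarAlgHom.norm_apply_le (α t⁻¹) _).trans ?_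
    rw [CStarRing.norm_star_mul_self, sq]

end ClosedIdeal

open ClosedIdeal

theorem SeparatesIdeals.isExactAction (h : SeparatesIdeals α) : IsExactAction α := by
  intro I hI
  refine ⟨(redSubtype_isometry hI).injective, fun x => ?_, redMk_surjective hI⟩
  have h1 : ker (redMk hI) = redRange hI := h <| Subtype.ext <|
    (interIdeal_ker_redMk hI).trans (interIdeal_redRange hI).symm
  rw [← mem_redRange, ← h1, mem_ker]

/-- If `A` separates ideals, then `J = Ideal[x]` is the kernel of the map to
`(A / (J ∩ A)) ⋊_r G`, and `E` maps this kernel to `J ∩ A`. -/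
theorem SeparatesIdeals.condExpMemIdeal (h : SeparatesIdeals α) : CondExpMemIdeal α := by
  intro x _
  set J := gen {x}
  have hI := interIdeal_invariant α J
  have h1 : ker (redMk hI) = J := h <| Subtype.ext <| interIdeal_ker_redMk hI
  have hx : x ∈ ker (redMk hI) := by rw [h1]; exact subset_gen {x} rfl
  exact condExp_mem_of_redMk_eq_zero hI hx

theorem CondExpMemIdeal.residualIntersectionProperty (h : CondExpMemIdeal α) :
    ResidualIntersectionProperty α := by
  rintro I hI J ⟨y, hy, hy0⟩
  obtain ⟨z, rfl⟩ := redMk_surjective hI y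
  refine ⟨Quot.cls I (Red.condExp α (star z * z)), ?_, fun h0 => hy0 ?_⟩
  · have h1 : Red.incl α (Red.condExp α (star z * z)) ∈ comap (redMk hI) J := by
      refine gen_le ?_ (h _ ⟨z, rfl⟩)
      rintro _ rfl
      change redMk hI (star z * z) ∈ J
      rw [map_mul]
      exact J.mul_mem_left _ hy
    change redMk hI _ ∈ J at h1
    rwa [redMk_incl] at h1
  · apply Red.eq_zero_of_condExp_star_mul_self
    rw [← map_star, ← map_mul, condExp_redMk, h0]

/-- For an exact action with the residual intersection property, every ideal `J` of `A ⋊_r G` is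
the kernel of the map to `(A / I) ⋊_r G`, where `I = J ∩ A`: the image of `J` is an ideal whose
intersection with `A / I` is zero. -/
theorem mem_iff_redMk_eq_zero (h : IsExactAction α) (h' : ResidualIntersectionProperty α)
    {I : ClosedIdeal A} (hI : I.Invariant α) {J : ClosedIdeal (Red α)} (hJ : interIdeal α J = I)
    (x : Red α) : x ∈ J ↔ redMk hI x = 0 := by
  subst hJ
  have hker : ∀ x, redMk hI x = 0 → x ∈ J := by
    intro x hx
    obtain ⟨y, rfl⟩ := ((h _ hI).2.1 x).1 hx
    exact redSubtype_mem hI (fun _ ha => ha) y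
  refine ⟨fun hx => ?_, hker x⟩
  by_contra h0
  obtain ⟨q, ⟨j, hj, hjq⟩, hq0⟩ := h' _ hI
    (mapOfSurjective (redMk hI) (redMk_surjective hI) J hker) ⟨_, ⟨x, hx, rfl⟩, h0⟩
  induction q using ClosedIdeal.Quot.ind with
  | h a =>
    have h1 : redMk hI (Red.incl α a) = redMk hI j := by rw [hjq, redMk_incl]
    have h2 : Red.incl α a - j ∈ J := hker _ (by rw [map_sub, h1, sub_self])
    have h3 : a ∈ interIdeal α J := by
      rw [mem_interIdeal, ← sub_add_cancel (Red.incl α a) j]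
      exact add_mem h2 hj
    exact hq0 (by rw [← Quot.cls_zero, Quot.cls_eq, sub_zero]; exact h3)

theorem IsExactAction.separatesIdeals (h : IsExactAction α)
    (h' : ResidualIntersectionProperty α) : SeparatesIdeals α := by
  intro J K hJK
  have h1 : interIdeal α J = interIdeal α K := congrArg Subtype.val hJK
  refine ext' fun x => ?_
  have hK := interIdeal_invariant α K
  rw [mem_iff_redMk_eq_zero h h' hK h1, mem_iff_redMk_eq_zero h h' hK rfl]

end Dynamics

end CStarDynamics

theorem theorem1p10 {A : Type*} [NonUnitalCStarAlgebra A] {G : Type*} [Group G]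
    (α : G →* (A ≃⋆ₐ[ℂ] A)) :
    List.TFAE [
      CStarDynamics.SeparatesIdeals α,
      CStarDynamics.IsExactAction α ∧ CStarDynamics.CondExpMemIdeal α,
      CStarDynamics.IsExactAction α ∧ CStarDynamics.ResidualIntersectionProperty α] := by
  tfae_have 1 → 2 := fun h => ⟨h.isExactAction, h.condExpMemIdeal⟩
  tfae_have 2 → 3 := fun h => ⟨h.1, h.2.residualIntersectionProperty⟩
  tfae_have 3 → 1 := fun h => h.1.separatesIdeals h.2
  tfae_finish
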